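/- A matroid is 2-connected if its ground set has no partition into two nonempty parts $X,Y$ with $r(X)+r(Y)=r(M)$. Let $M$ be a 2-connected matroid on a finite set $E$, with dual $M^*$, rank function $r$ and dual rank function $r^*$. A subset $L\subseteq E$ is locked in $M$ if $M|L$ and $M^*|(E\setminus L)$ are 2-connected and $\min\{r(L),r^*(E\setminus L)\}\ge 2$; $\mathcal L(M)$ is the class of locked subsets and $\ell(M)=|\mathcal L(M)|$. Let $\mathcal P(M)$ be the class of parallel closures of $M$, $\mathcal S(M)=\mathcal P(M^*)$ the class of its coparallel closures, and $\rho$ the restriction of $r$ to $\mathcal P(M)\cup\mathcal S(M)\cup\mathcal L(M)\cup\{\varnothing,E\}$. The quadruple $(\mathcal P(M),\mathcal S(M),\mathcal L(M),\rho)$ is the locked structure of $M$. For nonnegative integers $k$ and $c$, the $k$-locked oracle (with constant $c$ in $O(|E|^k)$) answers "no" if $\ell(M)>c|E|^k$ and otherwise returns $E$ together with the locked structure of $M$, each class being listed in an arbitrary order. Corollary 3.5. Let $k$ and $c$ be nonnegative integers, and consider the 2-connected matroids $M$ with $\ell(M)\le c|E|^k$, represented by the answer of the $k$-locked oracle. (1)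 Testing self-duality (is $M$ isomorphic to $M^*$?) for these matroids is polynomial-time many-one reducible to the graph isomorphism problem: there is an algorithm which, from the answer of the oracle for such an $M$, computes in time polynomial in $|E|$ two finite simple graphs that are isomorphic if and only if $M$ is self-dual. (2) There is an algorithm which, from the answer of the $k$-locked oracle for such an $M$, computes in time polynomial in $|E|$ the answer of the $k$-locked oracle (with the same constant $c$) for $M^*$; in particular, since $\ell(M^*)=\ell(M)\le c|E|^k$, it computes the locked structure of $M^*$. -/

import Mathlib

namespace LockedMatroid

/-! ### Matroids: connectivity, locked subsets, locked structure, duality -/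

section Matroids

variable {α : Type*}

/-- `M` is 2-connected: it has no 1-separation, i.e. there is no partition of the ground set into
two nonempty parts `X`, `Y` with `r(X) + r(Y) = r(M)`. -/
def TwoConnected (M : Matroid α) : Prop :=
  ∀ X ⊆ M.E, X.Nonempty → (M.E \ X).Nonempty → M.eRk M.E < M.eRk X + M.eRk (M.E \ X)

/-- `L` is locked in `M`: `M | L` and `M* | (E \ L)` are 2-connected, and `r(L)` and `r*(E \ L)`
are both at least 2. -/
def IsLocked (M : Matroid α) (L : Set α) : Prop :=
  L ⊆ M.E ∧ TwoConnected (M.restrict L) ∧ TwoConnected (M.dual.restrict (M.E \ L)) ∧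
    2 ≤ M.eRk L ∧ 2 ≤ M.dual.eRk (M.E \ L)

/-- The class of locked subsets of `M`. -/
def lockedSets (M : Matroid α) : Set (Set α) := {L | IsLocked M L}

/-- The locked number of `M`: the number of its locked subsets. -/
noncomputable def lockedNumber (M : Matroid α) : ℕ := (lockedSets M).ncard

/-- The parallel closure of `e`: the element `e` with all elements parallel to it. -/
def parallelClosure (M : Matroid α) (e : α) : Set α := {f ∈ M.E | f = e ∨ M.IsCircuit {e, f}}

/-- The class of parallel closures of `M`. -/
def parallelClosures (M : Matroid α) : Set (Set α) := {P | ∃ e ∈ M.E, P = parallelClosure M e}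

/-- The class of coparallel closures of `M`: the parallel closures of the dual matroid. -/
def coparallelClosures (M : Matroid α) : Set (Set α) := parallelClosures M.dual

/-- `M` is self-dual: some bijection of the ground set maps the bases of `M` exactly onto the
bases of its dual, i.e. `M` is isomorphic to its dual. -/
def SelfDual (M : Matroid α) : Prop :=
  ∃ φ : Equiv.Perm α, φ '' M.E = M.E ∧ ∀ B : Set α, M.IsBase B ↔ M.dual.IsBase (φ '' B)

end Matroids

/-- A quadruple `(P, S, L, ρ)` over the ground set `Fin n`: three classes of subsets and a
partial function on subsets (`none` outside its domain). -/
structure LockedStructure (n : ℕ) where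
  P : Set (Set (Fin n))
  S : Set (Set (Fin n))
  L : Set (Set (Fin n))
  ρ : Set (Fin n) → Option ℕ

open Classical in
/-- The locked structure of `M`: its parallel closures, coparallel closures and locked subsets,
and the restriction of its rank function to these sets, the empty set and the ground set. -/
noncomputable def lockedStructure {n : ℕ} (M : Matroid (Fin n)) : LockedStructure n where
  P := parallelClosures M
  S := coparallelClosures M
  L := lockedSets M
  ρ := fun X =>
    if X ∈ parallelClosures M ∪ coparallelClosures M ∪ lockedSets M ∪ {∅, M.E}
    then some (M.eRk X).toNat else none

open Classical in
/-- The `k`-locked oracle, `c` being the constant hidden in `O(|E|^k)`: it answers "no" (`none`)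
if `M` has more than `c |E|^k` locked subsets, and returns the locked structure otherwise. -/
noncomputable def lockedOracle (c k : ℕ) {n : ℕ} (M : Matroid (Fin n)) :
    Option (LockedStructure n) :=
  if lockedNumber M ≤ c * n ^ k then some (lockedStructure M) else none

/-! ### Words

Words are finite lists of natural numbers. All numbers occurring in the codes below are
bounded by the number of elements, of listed sets, or of vertices. -/

open Classical in
/-- The characteristic vector of a subset of `Fin n`. -/
noncomputable def charVec {n : ℕ} (X : Set (Fin n)) : List ℕ :=
  (List.finRange n).map fun i => if i ∈ X then 1 else 0

/-- Code of a list of sets: its length, and then for each set its value under `ρ` followed by its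
characteristic vector. -/
noncomputable def encodeSets {n : ℕ} (ρ : Set (Fin n) → Option ℕ) (l : List (Set (Fin n))) :
    List ℕ :=
  l.length :: l.flatMap fun X => (ρ X).getD 0 :: charVec X

/-- `w` lists all members of the classes of the quadruple `A` with their ranks, each
class in an arbitrary order and without repetition. -/
def CodesStructure {n : ℕ} (A : LockedStructure n) (w : List ℕ) : Prop :=
  ∃ lP lS lL : List (Set (Fin n)),
    lP.Nodup ∧ lS.Nodup ∧ lL.Nodup ∧
    (∀ X, X ∈ lP ↔ X ∈ A.P) ∧ (∀ X, X ∈ lS ↔ X ∈ A.S) ∧ (∀ X, X ∈ lL ↔ X ∈ A.L) ∧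
    w = (A.ρ ∅).getD 0 :: (A.ρ Set.univ).getD 0 ::
      (encodeSets A.ρ lP ++ encodeSets A.ρ lS ++ encodeSets A.ρ lL)

/-- `w` consists of the size `n` of the ground set and of the given answer of the oracle: `0` for
"no", and `1` followed by a code of the locked structure otherwise. -/
def CodesAnswer {n : ℕ} : Option (LockedStructure n) → List ℕ → Prop
  | none, w => w = [n, 0]
  | some A, w => ∃ v, CodesStructure A v ∧ w = n :: 1 :: v

open Classical in
/-- Code of a graph on `m` vertices: the number `m` followed by the `m * m` entries of its
adjacency matrix, row by row. -/
noncomputable def encodeGraph {m : ℕ} (G : SimpleGraph (Fin m)) : List ℕ :=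
  m :: (List.finRange m).flatMap fun i => (List.finRange m).map fun j =>
    if G.Adj i j then 1 else 0

/-! ### A random access machine with a step count

Programs work on registers and on arrays holding natural numbers, and write their output word
one entry at a time. Each elementary instruction and each test costs one step. Since the only
arithmetic is addition and (truncated) subtraction, polynomial time on this machine is
the usual polynomial time. -/

/-- Programs. Registers and arrays are named by natural numbers. -/
inductive Prog : Type
  /-- register `x` gets the constant `a` -/
  | const (x a : ℕ)
  /-- register `x` gets the sum of registers `y` and `z` -/
  | plus (x y z : ℕ)
  /-- register `x` gets the truncated difference of registers `y` and `z` -/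
  | minus (x y z : ℕ)
  /-- register `x` gets the entry of array `a` at the index held in register `y` -/
  | load (x a y : ℕ)
  /-- the entry of array `a` at the index held in register `x` gets the value of register `y` -/
  | store (a x y : ℕ)
  /-- the value of register `x` is appended to the output word -/
  | emit (x : ℕ)
  | seq (p q : Prog)
  /-- run `p` if register `x` is nonzero, and `q` otherwise -/
  | ite (x : ℕ) (p q : Prog)
  /-- repeat `p` as long as register `x` is nonzero -/
  | loop (x : ℕ) (p : Prog)

/-- A state of the machine. -/
structure State where
  reg : ℕ → ℕ
  mem : ℕ → ℕ → ℕ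
  out : List ℕ

/-- Overwrite register `x`. -/
def State.setReg (s : State) (x v : ℕ) : State := { s with reg := Function.update s.reg x v }

/-- Overwrite entry `i` of array `a`. -/
def State.setMem (s : State) (a i v : ℕ) : State :=
  { s with mem := Function.update s.mem a (Function.update (s.mem a) i v) }

/-- `Exec p s t s'`: started in state `s`, the program `p` halts in state `s'` after exactly
`t` steps. -/
inductive Exec : Prog → State → ℕ → State → Prop
  | const (x a : ℕ) (s : State) : Exec (.const x a) s 1 (s.setReg x a)
  | plus (x y z : ℕ) (s : State) : Exec (.plus x y z) s 1 (s.setReg x (s.reg y + s.reg z))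
  | minus (x y z : ℕ) (s : State) : Exec (.minus x y z) s 1 (s.setReg x (s.reg y - s.reg z))
  | load (x a y : ℕ) (s : State) : Exec (.load x a y) s 1 (s.setReg x (s.mem a (s.reg y)))
  | store (a x y : ℕ) (s : State) : Exec (.store a x y) s 1 (s.setMem a (s.reg x) (s.reg y))
  | emit (x : ℕ) (s : State) : Exec (.emit x) s 1 { s with out := s.out ++ [s.reg x] }
  | seq {p q : Prog} {s s₁ s₂ : State} {t₁ t₂ : ℕ} :
      Exec p s t₁ s₁ → Exec q s₁ t₂ s₂ → Exec (.seq p q) s (t₁ + t₂) s₂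
  | ite_pos {x : ℕ} {p q : Prog} {s s₁ : State} {t : ℕ} :
      s.reg x ≠ 0 → Exec p s t s₁ → Exec (.ite x p q) s (t + 1) s₁
  | ite_neg {x : ℕ} {p q : Prog} {s s₁ : State} {t : ℕ} :
      s.reg x = 0 → Exec q s t s₁ → Exec (.ite x p q) s (t + 1) s₁
  | loop_stop {x : ℕ} {p : Prog} {s : State} : s.reg x = 0 → Exec (.loop x p) s 1 s
  | loop_step {x : ℕ} {p : Prog} {s s₁ s₂ : State} {t₁ t₂ : ℕ} :
      s.reg x ≠ 0 → Exec p s t₁ s₁ → Exec (.loop x p) s₁ t₂ s₂ →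
        Exec (.loop x p) s (t₁ + t₂ + 1) s₂

/-- The initial state on input `w`: the word is in array 0, its length in register 0, everything
else is zero, and the output is empty. -/
def initState (w : List ℕ) : State where
  reg := fun x => if x = 0 then w.length else 0
  mem := fun a i => if a = 0 then w.getD i 0 else 0
  out := []

/-- On input `w` the program `p` halts after exactly `t` steps with output `w'`. -/
def Computes (p : Prog) (w : List ℕ) (t : ℕ) (w' : List ℕ) : Prop :=
  ∃ s, Exec p (initState w) t s ∧ s.out = w'

/-! ### Problems and polynomial-time reductions -/

/-- A class of instances with a notion of size, given to an algorithm through words;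
an instance may have several codes. -/
structure InstanceClass where
  Inst : Type
  size : Inst → ℕ
  Code : Inst → List ℕ → Prop

/-- The (multivalued) function sending an instance `x` of `A` to the words `w'` with `R x w'` is
computable in time polynomial in the size of `x`. -/
def PolyTimeComputable (A : InstanceClass) (R : A.Inst → List ℕ → Prop) : Prop :=
  ∃ (p : Prog) (b : Polynomial ℕ), ∀ (x : A.Inst) (w : List ℕ), A.Code x w →
    ∃ (t : ℕ) (w' : List ℕ), t ≤ b.eval (A.size x) ∧ Computes p w t w' ∧ R x w'

/-- A decision problem (with a promise: only codes of instances are admissible inputs). -/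
structure DecisionProblem extends InstanceClass where
  Yes : Inst → Prop

/-- Polynomial-time many-one reducibility: from every code of an instance of `A` one computes, in
time polynomial in the size of that instance, a code of an instance of `B` with the same answer. -/
def PolyTimeReducible (A B : DecisionProblem) : Prop :=
  PolyTimeComputable A.toInstanceClass fun x w' => ∃ y : B.Inst, B.Code y w' ∧ (A.Yes x ↔ B.Yes y)

/-- A 2-connected matroid with at most `c |E|^k` locked subsets; `E = {0, …, n - 1}`. -/
structure KLockedMatroid (c k : ℕ) where
  n : ℕ
  M : Matroid (Fin n)
  ground_eq : M.E = Set.univ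
  twoConnected : TwoConnected M
  locked_le : lockedNumber M ≤ c * n ^ k

/-- The 2-connected matroids with at most `c |E|^k` locked subsets, represented by the answer of
the `k`-locked oracle; the size of an instance is `|E|`. -/
def kLockedMatroids (c k : ℕ) : InstanceClass where
  Inst := KLockedMatroid c k
  size := fun x => x.n
  Code := fun x w => CodesAnswer (lockedOracle c k x.M) w

/-- Testing self-duality of the matroids of the above class. -/
def testingSelfDuality (c k : ℕ) : DecisionProblem where
  toInstanceClass := kLockedMatroids c k
  Yes := fun x => SelfDual x.M

/-- The graph isomorphism problem, for pairs of finite simple graphs. -/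
def graphIsomorphism : DecisionProblem where
  Inst := Σ (m m' : ℕ), SimpleGraph (Fin m) × SimpleGraph (Fin m')
  size := fun x => x.1 + x.2.1
  Code := fun x w => w = encodeGraph x.2.2.1 ++ encodeGraph x.2.2.2
  Yes := fun x => Nonempty (x.2.2.1 ≃g x.2.2.2)

end LockedMatroid

/-! The locked structure determines a 2-connected matroid. A set `B` of the right size is a base
unless it violates some inequality `|B ∩ X| ≤ r(X)`. Among the violated inequalities there is always
one coming from a flacet, a set connected both in the restriction and in the contraction
(`exists_violated_flacet`). To see this, move from the barycentre of the bases, which is in the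
relative interior of the base polytope, towards the indicator vector of `B`. At the exit point some
inequality is tight, and uncrossing tight sets by submodularity produces a tight flacet
(`exists_tight_flacet`). A violated flacet of rank at most 1 lies in a parallel closure, one whose
complement has corank at most 1 gives a coparallel closure, and any other is locked
(`isBase_iff_locked`).

Hence two such matroids on the same ground set are isomorphic exactly if their incidence graphs
(elements against listed sets) are, with vertex weights recording the class of a set, the rank of a
locked set and the rank of the matroid. Attaching `w(v)` pendant vertices to each vertex `v` turns
weights into graph structure; as `w(v) ≥ 2`, the original vertices are those with at least two
neighbours (`nonempty_pendantGraph_iso_iff`). Self-duality thus becomes isomorphism of the graphs of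
`M` and its dual.

The locked structure of the dual can be read off that of `M`: parallel and coparallel closures are
exchanged, locked sets are complemented, and the new ranks follow from cardinalities, the old ranks
and 2-connectedness. This gives the second claim, and the second graph in the first.

For polynomial time, both outputs are described by terms with addition, truncated subtraction,
access to the input word and bounded sums, and by bounded iterations writing their values. Such a
description is compiled to the machine once and for all. Its running time is polynomial in a bound
on the input entries (`polyTimeComputable_of_writer`), and these are at most `n + 1 + c * n ^ k`,
the list lengths included (`le_of_mem_codeWord`). -/

namespace LockedMatroid

/-! ### Polyhedral core: violated inequalities of the base polytope and flacets. -/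

section Flacets

variable {α : Type*} [Fintype α] [DecidableEq α]

/-- For a submodular function `r` without separators and a point `y` on the boundary of its scaled
base polytope, some tight proper nonempty set is connected both in the restriction and in the
contraction. -/
theorem exists_tight_flacet (r : Finset α → ℤ) (y : α → ℤ) (c : ℤ) (hc : 0 < c)
    (hsub : ∀ X Y, r (X ∪ Y) + r (X ∩ Y) ≤ r X + r Y) (h0 : r ∅ = 0)
    (hconn : ∀ X : Finset α, X.Nonempty → X ≠ Finset.univ → r Finset.univ < r X + r Xᶜ)
    (hle : ∀ X, ∑ i ∈ X, y i ≤ c * r X) (hE : ∑ i, y i = c * r Finset.univ)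
    (hex : ∃ X : Finset α, X.Nonempty ∧ X ≠ Finset.univ ∧ ∑ i ∈ X, y i = c * r X) :
    ∃ F : Finset α, F.Nonempty ∧ F ≠ Finset.univ ∧ ∑ i ∈ F, y i = c * r F ∧
      (∀ X Y, X.Nonempty → Y.Nonempty → Disjoint X Y → X ∪ Y = F → r F < r X + r Y) ∧
      (∀ X Y, X.Nonempty → Y.Nonempty → Disjoint X Y → X ∪ Y = Fᶜ →
        r F + r Finset.univ < r (F ∪ X) + r (F ∪ Y)) := by
  classical
  have hadd : ∀ X Y, Disjoint X Y → ∑ i ∈ X ∪ Y, y i = ∑ i ∈ X, y i + ∑ i ∈ Y, y i :=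
    fun X Y h => Finset.sum_union h
  have hsubadd : ∀ X Y, Disjoint X Y → r (X ∪ Y) ≤ r X + r Y := by
    intro X Y h
    have := hsub X Y
    rw [Finset.disjoint_iff_inter_eq_empty.mp h, h0] at this
    linarith
  -- pieces of a separated tight set are tight
  have hpiece : ∀ X Y, Disjoint X Y → ∑ i ∈ X ∪ Y, y i = c * r (X ∪ Y) → r X + r Y ≤ r (X ∪ Y) →
      ∑ i ∈ X, y i = c * r X ∧ ∑ i ∈ Y, y i = c * r Y := by
    intro X Y h ht hs
    have h1 := hle X
    have h2 := hle Y
    rw [hadd X Y h] at ht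
    have h3 := mul_le_mul_of_nonneg_left hs hc.le
    constructor <;> linarith
  have hcard : ∀ X Y : Finset α, Disjoint X Y → Y.Nonempty → X.card < (X ∪ Y).card := by
    intro X Y h hY
    rw [Finset.card_union_of_disjoint h]
    have := hY.card_pos
    omega
  let T : Finset (Finset α) := Finset.univ.filter fun X =>
    X.Nonempty ∧ X ≠ Finset.univ ∧ ∑ i ∈ X, y i = c * r X
  have hT : T.Nonempty := by
    obtain ⟨X, hX⟩ := hex
    exact ⟨X, by simpa [T] using hX⟩
  -- A tight set of least size has connected restriction, since a separation would yield smaller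
  -- tight sets. This makes `T'` below nonempty.
  obtain ⟨F₀, hF₀, hmin⟩ := Finset.exists_min_image T Finset.card hT
  have hF₀c : ∀ X Y, X.Nonempty → Y.Nonempty → Disjoint X Y → X ∪ Y = F₀ → r F₀ < r X + r Y := by
    intro X Y hX hY hd hu
    by_contra! hcon
    subst hu
    simp only [T, Finset.mem_filter, Finset.mem_univ, true_and] at hF₀ hmin
    have := hpiece X Y hd hF₀.2.2 hcon
    have h2 := hcard X Y hd hY
    have h3 := hmin X ⟨hX, ?_, this.1⟩
    · omega
    · rintro rfl
      have := Finset.card_le_univ (Finset.univ ∪ Y)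
      rw [← Finset.card_univ] at this
      omega
  let T' : Finset (Finset α) := T.filter fun F =>
    ∀ X Y, X.Nonempty → Y.Nonempty → Disjoint X Y → X ∪ Y = F → r F < r X + r Y
  obtain ⟨F, hF, hmax⟩ := Finset.exists_max_image T' Finset.card
    ⟨F₀, Finset.mem_filter.mpr ⟨hF₀, hF₀c⟩⟩
  simp only [T', T, Finset.mem_filter, Finset.mem_univ, true_and] at hF hmax
  obtain ⟨⟨hFn, hFu, hFt⟩, hFc⟩ := hF
  -- `F` splits off every tight proper set containing it
  have hsplit : ∀ G, F ⊆ G → G ≠ Finset.univ → ∑ i ∈ G, y i = c * r G →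
      r F + r (G \ F) ≤ r G := by
    intro G hFG hGu hGt
    let S : Finset (Finset α) := Finset.univ.filter fun K =>
      F ⊆ K ∧ K ⊆ G ∧ r K + r (G \ K) ≤ r G
    -- `K` is the smallest part containing `F` that splits off `G`. It turns out to be tight and
    -- connected, so the maximality of `F` gives `K = F`.
    obtain ⟨K, hK, hKmin⟩ := Finset.exists_min_image S Finset.card
      ⟨G, by simp [S, hFG, h0]⟩
    simp only [S, Finset.mem_filter, Finset.mem_univ, true_and] at hK hKmin
    obtain ⟨hFK, hKG, hKs⟩ := hK
    have hKd : Disjoint K (G \ K) := Finset.disjoint_sdiff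
    have hKun : K ∪ (G \ K) = G := Finset.union_sdiff_of_subset hKG
    have hKt : ∑ i ∈ K, y i = c * r K :=
      (hpiece K (G \ K) hKd (by rw [hKun]; exact hGt) (by rw [hKun]; exact hKs)).1
    have key : ∀ X Y, X.Nonempty → Y.Nonempty → Disjoint X Y → X ∪ Y = K → F ⊆ X →
        r X + r Y ≤ r K → False := by
      intro X Y hX hY hd hu hFX hs
      have h1 : r (G \ X) ≤ r Y + r (G \ K) := by
        have : G \ X = Y ∪ (G \ K) := by
          subst hu
          ext a
          have h4 : a ∈ X → a ∉ Y := fun h => Finset.disjoint_left.mp hd h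
          have h3 : a ∈ X ∪ Y → a ∈ G := fun h => hKG h
          simp only [Finset.mem_sdiff, Finset.mem_union] at *
          tauto
        rw [this]
        apply hsubadd
        exact (Finset.disjoint_sdiff.mono_left (hu ▸ Finset.subset_union_right))
      have h2 := hKmin X ⟨hFX, (hu ▸ Finset.subset_union_left : X ⊆ K).trans hKG, by linarith⟩
      have h3 := hcard X Y hd hY
      rw [hu] at h3
      omega
    have hKc : ∀ X Y, X.Nonempty → Y.Nonempty → Disjoint X Y → X ∪ Y = K → r K < r X + r Y := by
      intro X Y hX hY hd hu
      by_contra! hs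
      -- A separation of `K` cannot cut the connected set `F`: two applications of submodularity
      -- would separate `F` as well. So `F` lies on one side, and by `key` that side contradicts the
      -- minimality of `K`.
      by_cases hFX : (F ∩ X).Nonempty
      · by_cases hFY : (F ∩ Y).Nonempty
        · have h1 := hFc (F ∩ X) (F ∩ Y) hFX hFY
            (hd.mono Finset.inter_subset_right Finset.inter_subset_right)
            (by rw [← Finset.inter_union_distrib_left, hu, Finset.inter_eq_left.mpr hFK])
          have h2 := hsub F X
          have h3 := hsub (F ∪ X) Y
          have h4 : F ∪ X ∪ Y = K := by
            rw [Finset.union_assoc, hu, Finset.union_eq_right.mpr hFK]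
          have h5 : (F ∪ X) ∩ Y = F ∩ Y := by
            rw [Finset.union_inter_distrib_right, Finset.disjoint_iff_inter_eq_empty.mp hd,
              Finset.union_empty]
          rw [h4, h5] at h3
          linarith
        · refine key X Y hX hY hd hu ?_ hs
          intro a ha
          have h1 := hFK ha
          rw [← hu, Finset.mem_union] at h1
          refine h1.resolve_right fun h => hFY ⟨a, Finset.mem_inter.mpr ⟨ha, h⟩⟩
      · refine key Y X hY hX hd.symm (by rw [Finset.union_comm]; exact hu) ?_ (by linarith)
        intro a ha
        have h1 := hFK ha
        rw [← hu, Finset.mem_union] at h1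
        refine h1.resolve_left fun h => hFX ⟨a, Finset.mem_inter.mpr ⟨ha, h⟩⟩
    have hKu : K ≠ Finset.univ := by
      rintro rfl
      exact hGu (Finset.univ_subset_iff.mp hKG)
    have h1 := hmax K ⟨⟨hFn.mono hFK, hKu, hKt⟩, hKc⟩
    rw [Finset.eq_of_subset_of_card_le hFK h1]
    exact hKs
  refine ⟨F, hFn, hFu, hFt, hFc, ?_⟩
  intro A C hA hC hd hu
  -- A separation `A`, `C` of the contraction makes `F ∪ A` and `F ∪ C` tight. Then `F` splits off
  -- both, and adding the two inequalities splits `F` off the whole ground set, against `hconn`.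
  by_contra! hs
  have hFA : Disjoint F A := disjoint_compl_right.mono_right (hu ▸ Finset.subset_union_left)
  have hFC : Disjoint F C := disjoint_compl_right.mono_right (hu ▸ Finset.subset_union_right)
  have htot : ∑ i, y i = ∑ i ∈ F, y i + (∑ i ∈ A, y i + ∑ i ∈ C, y i) := by
    rw [← hadd A C hd, hu, Finset.sum_add_sum_compl]
  have h1 := hle (F ∪ A)
  have h2 := hle (F ∪ C)
  have h3 := hadd F A hFA
  have h4 := hadd F C hFC
  have h5 := mul_le_mul_of_nonneg_left hs hc.le
  have hne : ∀ A C : Finset α, C.Nonempty → Disjoint F C → Disjoint A C → F ∪ A ≠ Finset.univ := by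
    rintro A C ⟨a, ha⟩ hF hA h
    have := Finset.mem_univ a
    rw [← h, Finset.mem_union] at this
    exact this.elim (fun h => Finset.disjoint_left.mp hF h ha)
      (fun h => Finset.disjoint_left.mp hA h ha)
  have h6 := hsplit (F ∪ A) Finset.subset_union_left (hne A C hC hFC hd) (by linarith)
  have h7 := hsplit (F ∪ C) Finset.subset_union_left (hne C A hA hFA hd.symm) (by linarith)
  rw [Finset.union_sdiff_cancel_left hFA] at h6
  rw [Finset.union_sdiff_cancel_left hFC] at h7
  have h8 := hconn F hFn hFu
  have h9 := hsubadd A C hd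
  rw [hu] at h9
  linarith

/-- If the point `z / N` is in the relative interior of the base polytope of `r` and the point `b`
violates one of its inequalities, then `b` violates an inequality given by a set that is connected
both in the restriction and in the contraction. -/
theorem exists_violated_flacet (r : Finset α → ℤ) (z b : α → ℤ) (N : ℤ) (hN : 0 ≤ N)
    (hsub : ∀ X Y, r (X ∪ Y) + r (X ∩ Y) ≤ r X + r Y) (h0 : r ∅ = 0)
    (hconn : ∀ X : Finset α, X.Nonempty → X ≠ Finset.univ → r Finset.univ < r X + r Xᶜ)
    (hz : ∀ X : Finset α, X.Nonempty → X ≠ Finset.univ → ∑ i ∈ X, z i < N * r X)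
    (hzE : ∑ i, z i = N * r Finset.univ) (hbE : ∑ i, b i = r Finset.univ)
    (hex : ∃ X : Finset α, X.Nonempty ∧ X ≠ Finset.univ ∧ r X < ∑ i ∈ X, b i) :
    ∃ F : Finset α, F.Nonempty ∧ F ≠ Finset.univ ∧ r F < ∑ i ∈ F, b i ∧
      (∀ X Y, X.Nonempty → Y.Nonempty → Disjoint X Y → X ∪ Y = F → r F < r X + r Y) ∧
      (∀ X Y, X.Nonempty → Y.Nonempty → Disjoint X Y → X ∪ Y = Fᶜ →
        r F + r Finset.univ < r (F ∪ X) + r (F ∪ Y)) := by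
  let f : Finset α → ℤ := fun X => r X - ∑ i ∈ X, b i
  let g : Finset α → ℤ := fun X => N * r X - ∑ i ∈ X, z i
  have hg : ∀ X : Finset α, X.Nonempty → X ≠ Finset.univ → 0 < g X := fun X h h' =>
    sub_pos.mpr (hz X h h')
  let T : Finset (Finset α) := Finset.univ.filter fun X => X.Nonempty ∧ X ≠ Finset.univ
  obtain ⟨Z, hZn, hZu, hZ⟩ := hex
  have hZT : Z ∈ T := by
    simp only [T, Finset.mem_filter, Finset.mem_univ, true_and]
    exact ⟨hZn, hZu⟩
  -- `f` and `g` are the slacks at `b` and at `z`. The set with the least ratio gives the inequality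
  -- at which the segment from `z / N` to `b` leaves the polytope.
  obtain ⟨F₀, hF₀, hmin⟩ := Finset.exists_min_image T (fun X => (f X : ℚ) / g X) ⟨Z, hZT⟩
  simp only [T, Finset.mem_filter, Finset.mem_univ, true_and] at hF₀ hmin
  have hg0 := hg F₀ hF₀.1 hF₀.2
  have hcross : ∀ X : Finset α, X.Nonempty → X ≠ Finset.univ → f F₀ * g X ≤ f X * g F₀ := by
    intro X hX hX'
    have h1 := hmin X ⟨hX, hX'⟩
    rw [div_le_div_iff₀ (by exact_mod_cast hg0) (by exact_mod_cast hg X hX hX')] at h1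
    exact_mod_cast h1
  have hf0 : f F₀ < 0 := by
    have h1 := hcross Z hZn hZu
    have h2 : f Z < 0 := sub_neg.mpr hZ
    by_contra! h3
    have h4 := mul_nonneg h3 (hg Z hZn hZu).le
    have h5 := mul_neg_of_neg_of_pos h2 hg0
    linarith
  -- The exit point, scaled by the positive factor `g F₀ - f F₀ * N` to stay integral. Its slack is
  -- `f X * g F₀ - f F₀ * g X`, which is nonnegative by the choice of `F₀` and vanishes at `F₀`.
  have hsum : ∀ X : Finset α, ∑ i ∈ X, (g F₀ * b i - f F₀ * z i) =
      (g F₀ - f F₀ * N) * r X - (f X * g F₀ - f F₀ * g X) := by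
    intro X
    rw [Finset.sum_sub_distrib, ← Finset.mul_sum, ← Finset.mul_sum]
    simp only [f, g]
    ring
  have hfu : f Finset.univ = 0 := by simp [f, hbE]
  have hgu : g Finset.univ = 0 := by simp [g, hzE]
  have hc : 0 < g F₀ - f F₀ * N := by
    have := mul_nonneg (neg_pos.mpr hf0).le hN
    linarith
  obtain ⟨F, hF, hFu, hFt, hF1, hF2⟩ := exists_tight_flacet r (fun i => g F₀ * b i - f F₀ * z i)
    (g F₀ - f F₀ * N) hc hsub h0 hconn
    (by
      intro X
      rw [hsum]
      by_cases hX : X.Nonempty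
      · by_cases hX' : X = Finset.univ
        · rw [hX', hfu, hgu]; simp
        · have := hcross X hX hX'
          linarith
      · rw [Finset.not_nonempty_iff_eq_empty.mp hX]
        simp [f, g, h0])
    (by rw [hsum, hfu, hgu]; simp)
    ⟨F₀, hF₀.1, hF₀.2, by rw [hsum]; simp⟩
  refine ⟨F, hF, hFu, ?_, hF1, hF2⟩
  rw [hsum] at hFt
  have h1 : f F * g F₀ = f F₀ * g F := by linarith
  have h2 := mul_neg_of_neg_of_pos hf0 (hg F hF hFu)
  rw [← h1] at h2
  exact sub_neg.mp (neg_of_mul_neg_left h2 hg0.le)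

end Flacets

/-! ### Natural-valued rank, connectivity and parallel classes. -/

section Rank

variable {α : Type*} [Finite α]

/-- The rank function of a matroid on a finite type, with natural values. -/
noncomputable def rk (M : Matroid α) (X : Set α) : ℕ := (M.eRk X).toNat

theorem cast_rk (M : Matroid α) (X : Set α) : (rk M X : ℕ∞) = M.eRk X := by
  apply ENat.natCast_toNat
  have := (M.eRk_le_encard X).trans_lt X.toFinite.encard_lt_top
  exact this.ne

omit [Finite α] in
theorem rk_empty (M : Matroid α) : rk M ∅ = 0 := by simp [rk]

theorem rk_mono (M : Matroid α) {X Y : Set α} (h : X ⊆ Y) : rk M X ≤ rk M Y := by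
  have := M.eRk_mono h
  rw [← cast_rk, ← cast_rk] at this
  exact_mod_cast this

theorem rk_le_ncard (M : Matroid α) (X : Set α) : rk M X ≤ X.ncard := by
  have := M.eRk_le_encard X
  rw [← cast_rk, ← X.toFinite.cast_ncard_eq] at this
  exact_mod_cast this

theorem rk_submod (M : Matroid α) (X Y : Set α) :
    rk M (X ∪ Y) + rk M (X ∩ Y) ≤ rk M X + rk M Y := by
  have := M.eRk_inter_add_eRk_union_le X Y
  simp only [← cast_rk] at this
  rw [add_comm]
  exact_mod_cast this

theorem indep_iff_rk {M : Matroid α} {I : Set α} : M.Indep I ↔ rk M I = I.ncard := by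
  rw [Matroid.indep_iff_eRk_eq_encard_of_finite I.toFinite, ← cast_rk,
    ← I.toFinite.cast_ncard_eq]
  norm_cast

theorem isBase_iff_rk {M : Matroid α} {B : Set α} :
    M.IsBase B ↔ B.ncard = rk M Set.univ ∧ rk M B = B.ncard := by
  have hr : M.eRank = (rk M Set.univ : ℕ∞) := by rw [cast_rk, M.eRk_univ_eq]
  constructor
  · intro h
    refine ⟨?_, indep_iff_rk.mp h.indep⟩
    have := h.encard_eq_eRank
    rw [hr, ← B.toFinite.cast_ncard_eq] at this
    exact_mod_cast this
  · rintro ⟨h1, h2⟩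
    refine (indep_iff_rk.mpr h2).isBase_of_eRk_ge B.toFinite ?_
    rw [hr, ← cast_rk, h2, h1]

theorem twoConnected_restrict_iff {M : Matroid α} {L : Set α} :
    TwoConnected (M.restrict L) ↔
      ∀ X ⊆ L, X.Nonempty → (L \ X).Nonempty → rk M L < rk M X + rk M (L \ X) := by
  refine forall_congr' fun X => forall_congr' fun hX => forall_congr' fun _ =>
    forall_congr' fun _ => ?_
  rw [Matroid.restrict_ground_eq] at *
  rw [Matroid.restrict_eRk_eq _ hX, Matroid.restrict_eRk_eq _ subset_rfl,
    Matroid.restrict_eRk_eq _ Set.sdiff_subset, ← cast_rk, ← cast_rk, ← cast_rk]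
  norm_cast

theorem twoConnected_iff {M : Matroid α} (hE : M.E = Set.univ) :
    TwoConnected M ↔
      ∀ X : Set α, X.Nonempty → Xᶜ.Nonempty → rk M Set.univ < rk M X + rk M Xᶜ := by
  unfold TwoConnected
  simp only [hE, Set.subset_univ, true_implies, ← Set.compl_eq_univ_sdiff, ← cast_rk]
  norm_cast

theorem rk_dual {M : Matroid α} (hE : M.E = Set.univ) (X : Set α) :
    rk M.dual X + rk M Set.univ = rk M Xᶜ + X.ncard := by
  have := M.eRk_dual_add_eRank X (by simp [hE])
  rw [← M.eRk_univ_eq, hE, ← Set.compl_eq_univ_sdiff, ← cast_rk, ← cast_rk, ← cast_rk,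
    ← X.toFinite.cast_ncard_eq] at this
  exact_mod_cast this

/-- The connectivity function `r(X) + r(Xᶜ) - r(E)` takes the same values for the dual, by the
formula for the dual rank. -/
theorem twoConnected_dual {M : Matroid α} (hE : M.E = Set.univ) (h : TwoConnected M) :
    TwoConnected M.dual := by
  rw [twoConnected_iff hE] at h
  rw [twoConnected_iff (by simpa using hE)]
  intro X hX hX'
  have h1 := h X hX hX'
  have h2 := rk_dual hE X
  have h3 := rk_dual hE Xᶜ
  have h4 := rk_dual hE Set.univ
  have h5 := Set.ncard_add_ncard_compl X
  rw [compl_compl] at h3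
  rw [Set.compl_univ, rk_empty, Set.ncard_univ] at h4
  omega

omit [Finite α] in
theorem isBase_dual_iff {M : Matroid α} (hE : M.E = Set.univ) {B : Set α} :
    M.dual.IsBase B ↔ M.IsBase Bᶜ := by
  rw [Matroid.dual_isBase_iff (by simp [hE]), hE, Set.compl_eq_univ_sdiff]

theorem rk_parallelClosure_le (M : Matroid α) (e : α) : rk M (parallelClosure M e) ≤ 1 := by
  have h : parallelClosure M e ⊆ M.closure {e} := by
    rintro f ⟨hf, rfl | hc⟩
    · exact M.mem_closure_of_mem (by simp) (by simpa using hf)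
    · by_cases hef : f = e
      · subst hef
        exact M.mem_closure_of_mem (by simp) (by simpa using hf)
      · have := hc.mem_closure_sdiff_singleton_of_mem (e := f) (by simp)
        refine M.closure_subset_closure ?_ this
        rintro x ⟨rfl | rfl, hx⟩
        · rfl
        · exact absurd rfl hx
  have h1 : M.eRk (parallelClosure M e) ≤ 1 :=
    (M.eRk_mono h).trans (by rw [M.eRk_closure_eq]; exact M.eRk_singleton_le e)
  rw [← cast_rk M] at h1
  exact_mod_cast h1

/-- A loop would be one side of a separation. The complement must be nonempty because a single loop
alone is a 2-connected matroid. -/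
theorem rk_singleton {M : Matroid α} (hE : M.E = Set.univ) (h : TwoConnected M) (e : α)
    (he : ({e}ᶜ : Set α).Nonempty) : rk M {e} = 1 := by
  have h1 := (twoConnected_iff hE).mp h {e} (by simp) he
  have h2 := rk_le_ncard M {e}
  have h3 := rk_mono M (Set.subset_univ ({e}ᶜ))
  rw [Set.ncard_singleton] at h2
  omega

/-- There are no loops, so any two distinct elements of a set of rank at most 1 form a circuit. This
sends flacets of small rank or corank to (co)parallel closures. -/
theorem subset_parallelClosure {M : Matroid α} (hE : M.E = Set.univ) (h : TwoConnected M)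
    {F : Set α} (hF : Fᶜ.Nonempty) (hr : rk M F ≤ 1) {e : α} (he : e ∈ F) :
    F ⊆ parallelClosure M e := by
  have h1 : ∀ x ∈ F, M.Indep {x} := fun x hx => by
    rw [indep_iff_rk, Set.ncard_singleton]
    exact rk_singleton hE h x (hF.mono (by simpa using hx))
  intro f hf
  refine ⟨by simp [hE], ?_⟩
  by_cases hef : f = e
  · exact Or.inl hef
  · right
    rw [Matroid.isCircuit_iff_dep_forall_sdiff_singleton_indep]
    constructor
    · rw [← Matroid.not_indep_iff (by simp [hE]), indep_iff_rk, Set.ncard_pair (Ne.symm hef)]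
      have := rk_mono M (show ({e, f} : Set α) ⊆ F by
        rintro x (rfl | rfl) <;> assumption)
      omega
    · rintro x (rfl | rfl)
      · rw [Set.pair_sdiff_left (Ne.symm hef)]; exact h1 _ hf
      · rw [Set.pair_sdiff_right (Ne.symm hef)]; exact h1 _ he

theorem ncard_inter_le_rk {M : Matroid α} {B : Set α} (hB : M.IsBase B) (X : Set α) :
    (B ∩ X).ncard ≤ rk M X := by
  rw [← indep_iff_rk.mp (hB.indep.subset Set.inter_subset_left)]
  exact rk_mono M Set.inter_subset_right

end Rank

/-! ### The locked structure determines the bases. -/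

section Determined

variable {α : Type*} [Finite α]

/-- The bases of a 2-connected matroid satisfy, and are determined by, the inequalities given by
its rank, parallel closures, coparallel closures and locked subsets. -/
theorem isBase_iff_locked {M : Matroid α} (hE : M.E = Set.univ) (hM : TwoConnected M)
    (B : Set α) :
    M.IsBase B ↔ B.ncard = rk M Set.univ ∧ (∀ P ∈ parallelClosures M, (B ∩ P).ncard ≤ 1) ∧
      (∀ S ∈ coparallelClosures M, (S \ B).ncard ≤ 1) ∧
      ∀ L ∈ lockedSets M, (B ∩ L).ncard ≤ rk M L := by
  classical
  have hEd : M.dual.E = Set.univ := by simpa using hE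
  have hMd := twoConnected_dual hE hM
  constructor
  · intro hB
    refine ⟨((isBase_iff_rk).mp hB).1, ?_, ?_, fun L _ => ncard_inter_le_rk hB L⟩
    · rintro P ⟨e, -, rfl⟩
      exact (ncard_inter_le_rk hB _).trans (rk_parallelClosure_le M e)
    · rintro S ⟨e, -, rfl⟩
      have hB' : M.dual.IsBase Bᶜ := (isBase_dual_iff hE).mpr (by rwa [compl_compl])
      rw [Set.sdiff_eq, Set.inter_comm]
      exact (ncard_inter_le_rk hB' _).trans (rk_parallelClosure_le M.dual e)
  · rintro ⟨hcard, hP, hS, hL⟩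
    by_contra hB
    have := Fintype.ofFinite α
    have hlt : rk M B < B.ncard := by
      refine (rk_le_ncard M B).lt_of_ne fun h => hB ((isBase_iff_rk).mpr ⟨hcard, h⟩)
    have hind : ∀ (D : Set α) (X : Finset α),
        ∑ i ∈ X, (if i ∈ D then (1 : ℤ) else 0) = ((D ∩ X).ncard : ℤ) := by
      intro D X
      rw [Finset.sum_boole]
      congr 1
      rw [← Set.ncard_coe_finset]
      congr 1
      ext a
      simp [and_comm]
    -- The interior point is the barycentre of all bases: `z` is the sum of their indicator vectors
    -- and `N` their number.
    let bases : Finset (Set α) := Finset.univ.filter fun D => M.IsBase D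
    have hbases : ∀ D, D ∈ bases ↔ M.IsBase D := by simp [bases]
    have hzsum : ∀ X : Finset α, ∑ i ∈ X, ∑ D ∈ bases, (if i ∈ D then (1 : ℤ) else 0) =
        ∑ D ∈ bases, ((D ∩ X).ncard : ℤ) := by
      intro X
      rw [Finset.sum_comm]
      exact Finset.sum_congr rfl fun D _ => hind D X
    obtain ⟨F, hFn, hFu, hFb, hF1, hF2⟩ := exists_violated_flacet
      (fun X : Finset α => (rk M (X : Set α) : ℤ))
      (fun i => ∑ D ∈ bases, if i ∈ D then (1 : ℤ) else 0)
      (fun i => if i ∈ B then (1 : ℤ) else 0) bases.card (by positivity)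
      (by
        intro X Y
        have := rk_submod M (X : Set α) Y
        rw [Finset.coe_union, Finset.coe_inter]
        exact_mod_cast this)
      (by simp [rk_empty])
      (by
        intro X hX hX'
        have := (twoConnected_iff hE).mp hM X (by simpa using hX)
          (by rw [Set.nonempty_compl]; simpa using hX')
        rw [Finset.coe_compl, Finset.coe_univ]
        exact_mod_cast this)
      (by
        intro X hX hX'
        rw [hzsum, ← nsmul_eq_mul, ← Finset.sum_const]
        refine Finset.sum_lt_sum (fun D hD => ?_) ?_
        · exact_mod_cast ncard_inter_le_rk ((hbases D).mp hD) _
        -- For strictness at `X`, a base extending a basis of the complement meets `X` in at most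
        -- `r(E) - r(Xᶜ)` elements, which is less than `r(X)` by 2-connectedness.
        · obtain ⟨I, hI⟩ := M.exists_isBasis ((X : Set α)ᶜ) (by simp [hE])
          obtain ⟨D, hD, hID⟩ := hI.indep.exists_isBase_superset
          refine ⟨D, (hbases D).mpr hD, ?_⟩
          have h1 := (twoConnected_iff hE).mp hM X (by simpa using hX)
            (by rw [Set.nonempty_compl]; simpa using hX')
          have h2 : rk M ((X : Set α)ᶜ) ≤ (D \ X).ncard := by
            have : rk M ((X : Set α)ᶜ) = I.ncard := by
              have h3 := hI.eRk_eq_encard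
              rw [← cast_rk, ← I.toFinite.cast_ncard_eq] at h3
              exact_mod_cast h3
            rw [this]
            refine Set.ncard_le_ncard (fun x hx => ⟨hID hx, hI.subset hx⟩) (Set.toFinite _)
          have h3 := ((isBase_iff_rk).mp hD).1
          have h4 := Set.ncard_inter_add_ncard_sdiff_eq_ncard D (X : Set α) D.toFinite
          have : (D ∩ X).ncard < rk M X := by omega
          exact_mod_cast this)
      (by
        rw [hzsum, ← nsmul_eq_mul, ← Finset.sum_const]
        refine Finset.sum_congr rfl fun D hD => ?_
        rw [Finset.coe_univ, Set.inter_univ, ((isBase_iff_rk).mp ((hbases D).mp hD)).1])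
      (by rw [hind, Finset.coe_univ, Set.inter_univ, hcard])
      -- The set `B` itself gives a violated inequality, being a dependent set of size `r(E)`.
      ⟨B.toFinite.toFinset, by
        rw [Set.Finite.toFinset_nonempty, ← Set.ncard_pos]; omega, by
        intro h
        have h1 : B = Set.univ := by simpa using h
        rw [h1] at hcard hlt
        omega, by
        rw [hind, Set.Finite.coe_toFinset, Set.inter_self]
        exact_mod_cast hlt⟩
    simp only [hind] at hFb
    have hFn' : (F : Set α).Nonempty := by simpa using hFn
    have hFc' : ((F : Set α)ᶜ).Nonempty := by rw [Set.nonempty_compl]; simpa using hFu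
    have hFb' : rk M (F : Set α) < (B ∩ F).ncard := by exact_mod_cast hFb
    have hconn := (twoConnected_iff hE).mp hM F hFn' hFc'
    have h1 := rk_mono M (Set.subset_univ ((F : Set α)ᶜ))
    have h2 := rk_mono M (Set.subset_univ (F : Set α))
    have hd := rk_dual hE ((F : Set α)ᶜ)
    rw [compl_compl] at hd
    have hconn' := (twoConnected_iff hEd).mp hMd _ hFc' (by rwa [compl_compl])
    rw [compl_compl] at hconn'
    have h1' := rk_mono M.dual (Set.subset_univ (F : Set α))
    -- Combined with `hd`, this turns the violation at `F` into the violation `r*(Fᶜ) < |Fᶜ \ B|`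
    -- for the dual.
    have hex : ((F : Set α)ᶜ \ B).ncard + B.ncard = ((F : Set α)ᶜ).ncard + (B ∩ F).ncard := by
      have e1 := Set.ncard_inter_add_ncard_sdiff_eq_ncard B (F : Set α) B.toFinite
      have e2 := Set.ncard_inter_add_ncard_sdiff_eq_ncard ((F : Set α)ᶜ) B (Set.toFinite _)
      have e3 : (F : Set α)ᶜ ∩ B = B \ F := by rw [Set.inter_comm]; rfl
      rw [e3] at e2
      omega
    by_cases hr1 : rk M (F : Set α) ≤ 1
    · obtain ⟨e, he⟩ := hFn'
      have h3 := subset_parallelClosure hE hM hFc' hr1 he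
      have h4 := hP _ ⟨e, by simp [hE], rfl⟩
      have h5 : (B ∩ F).ncard ≤ (B ∩ parallelClosure M e).ncard :=
        Set.ncard_le_ncard (Set.inter_subset_inter_right B h3) (Set.toFinite _)
      omega
    by_cases hr2 : rk M.dual ((F : Set α)ᶜ) ≤ 1
    · obtain ⟨e, he⟩ := hFc'
      have h3 := subset_parallelClosure hEd hMd (by rwa [compl_compl]) hr2 he
      have h4 := hS _ ⟨e, by simp [hE], rfl⟩
      have h5 : ((F : Set α)ᶜ \ B).ncard ≤ (parallelClosure M.dual e \ B).ncard :=
        Set.ncard_le_ncard (Set.sdiff_subset_sdiff_left h3) (Set.toFinite _)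
      omega
    have hlock : IsLocked M F := by
      refine ⟨by simp [hE], ?_, ?_, ?_, ?_⟩
      · rw [twoConnected_restrict_iff]
        intro X hX hXn hXn'
        have := hF1 (X.toFinite.toFinset) (((F : Set α) \ X).toFinite.toFinset)
          (by simpa using hXn) ((Set.Finite.toFinset_nonempty _).mpr hXn')
          (by rw [Set.Finite.disjoint_toFinset]; exact Set.disjoint_sdiff_right)
          (by
            rw [← Finset.coe_inj, Finset.coe_union, Set.Finite.coe_toFinset,
              Set.Finite.coe_toFinset, Set.union_sdiff_cancel hX])
        rw [Set.Finite.coe_toFinset, Set.Finite.coe_toFinset] at this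
        exact_mod_cast this
      · rw [twoConnected_restrict_iff, hE, ← Set.compl_eq_univ_sdiff]
        intro X hX hXn hXn'
        have := hF2 (X.toFinite.toFinset) (((F : Set α)ᶜ \ X).toFinite.toFinset)
          (by simpa using hXn) ((Set.Finite.toFinset_nonempty _).mpr hXn')
          (by rw [Set.Finite.disjoint_toFinset]; exact Set.disjoint_sdiff_right)
          (by
            rw [← Finset.coe_inj, Finset.coe_union, Set.Finite.coe_toFinset,
              Set.Finite.coe_toFinset, Set.union_sdiff_cancel hX, Finset.coe_compl])
        rw [Finset.coe_union, Finset.coe_union, Finset.coe_univ, Set.Finite.coe_toFinset,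
          Set.Finite.coe_toFinset] at this
        have e1 : ((F : Set α)ᶜ \ X)ᶜ = (F : Set α) ∪ X := by
          rw [Set.sdiff_eq, Set.compl_inter, compl_compl, compl_compl]
        have e2 : (F : Set α) ∪ ((F : Set α)ᶜ \ X) = Xᶜ := by
          ext a
          have := @hX a
          simp only [Set.mem_union, Set.mem_sdiff, Set.mem_compl_iff] at *
          tauto
        rw [e2] at this
        -- The dual rank formula converts connectivity of the contraction by `F` into connectivity
        -- of the dual restricted to `Fᶜ`.
        have d1 := rk_dual hE X
        have d2 := rk_dual hE ((F : Set α)ᶜ \ X)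
        rw [e1] at d2
        have d3 := Set.ncard_sdiff_add_ncard_of_subset hX (Set.toFinite _)
        have : rk M (F : Set α) + rk M Set.univ < rk M ((F : Set α) ∪ X) + rk M Xᶜ := by
          exact_mod_cast this
        omega
      · rw [← cast_rk]
        exact_mod_cast (show 2 ≤ rk M (F : Set α) by omega)
      · rw [← cast_rk, hE, ← Set.compl_eq_univ_sdiff]
        exact_mod_cast (show 2 ≤ rk M.dual ((F : Set α)ᶜ) by omega)
    have := hL _ hlock
    omega

end Determined

/-! ### Reading the dual locked structure off the primal one. -/

section DualStructure

variable {n : ℕ} {M : Matroid (Fin n)}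

/-- The definition of a locked set is symmetric under exchanging `M` with its dual and `L` with its
complement. -/
theorem mem_lockedSets_dual {α : Type*} {M : Matroid α} (hE : M.E = Set.univ) {L : Set α} :
    L ∈ lockedSets M.dual ↔ Lᶜ ∈ lockedSets M := by
  simp only [lockedSets, IsLocked, Set.mem_ofPred_eq, Matroid.dual_ground, hE,
    Matroid.dual_dual, ← Set.compl_eq_univ_sdiff, compl_compl, Set.subset_univ, true_and]
  tauto

theorem lockedNumber_dual {α : Type*} {M : Matroid α} (hE : M.E = Set.univ) :
    lockedNumber M.dual = lockedNumber M := by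
  have : lockedSets M.dual = compl '' lockedSets M := by
    ext L
    rw [mem_lockedSets_dual hE, Set.mem_image]
    exact ⟨fun h => ⟨_, h, compl_compl L⟩, by rintro ⟨K, h, rfl⟩; rwa [compl_compl]⟩
  rw [lockedNumber, this, Set.ncard_image_of_injective _ compl_injective]
  rfl

theorem coparallelClosures_dual {α : Type*} (M : Matroid α) :
    coparallelClosures M.dual = parallelClosures M := by
  rw [coparallelClosures, Matroid.dual_dual]

theorem rk_dual_univ (hE : M.E = Set.univ) : rk M.dual Set.univ = n - rk M Set.univ := by
  have := rk_dual hE Set.univ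
  simp only [Set.compl_univ, rk_empty, Set.ncard_univ, Nat.card_eq_fintype_card,
    Fintype.card_fin] at this
  omega

theorem ncard_eq_iff_eq_univ {X : Set (Fin n)} : X.ncard = n ↔ X = Set.univ := by
  have h : (Set.univ : Set (Fin n)).ncard = n := by simp [Set.ncard_univ]
  constructor
  · intro hX
    exact Set.eq_of_subset_of_ncard_le (Set.subset_univ X) (by omega) (Set.toFinite _)
  · rintro rfl
    exact h

/-- For a proper parallel closure, `r(P) ≤ 1` and 2-connectedness force `r(Pᶜ) = r(E)`, so `P` is
independent in the dual. The case split tests only a cardinality, which the machine can compute. -/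
theorem rk_dual_of_mem_parallelClosures (hE : M.E = Set.univ) (hM : TwoConnected M)
    {P : Set (Fin n)} (hP : P ∈ parallelClosures M) :
    rk M.dual P = if P.ncard = n then n - rk M Set.univ else P.ncard := by
  simp only [ncard_eq_iff_eq_univ]
  split_ifs with h
  · rw [h, rk_dual_univ hE]
  · obtain ⟨e, he, rfl⟩ := hP
    have h1 := (twoConnected_iff hE).mp hM (parallelClosure M e) ⟨e, he, Or.inl rfl⟩
      (Set.nonempty_compl.mpr h)
    have h2 := rk_parallelClosure_le M e
    have h3 := rk_dual hE (parallelClosure M e)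
    have h4 := rk_mono M (Set.subset_univ (parallelClosure M e)ᶜ)
    omega

/-- The dual is 2-connected, so a proper coparallel closure cannot have dual rank 0. -/
theorem rk_dual_of_mem_coparallelClosures (hE : M.E = Set.univ) (hM : TwoConnected M)
    {S : Set (Fin n)} (hS : S ∈ coparallelClosures M) :
    rk M.dual S = if S.ncard = n then n - rk M Set.univ else 1 := by
  simp only [ncard_eq_iff_eq_univ]
  split_ifs with h
  · rw [h, rk_dual_univ hE]
  · obtain ⟨e, he, rfl⟩ := hS
    have h1 := (twoConnected_iff (M := M.dual) (by simpa using hE)).mp (twoConnected_dual hE hM)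
      (parallelClosure M.dual e) ⟨e, he, Or.inl rfl⟩ (Set.nonempty_compl.mpr h)
    have h2 := rk_parallelClosure_le M.dual e
    have h4 := rk_mono M.dual (Set.subset_univ (parallelClosure M.dual e)ᶜ)
    omega

theorem rk_dual_compl (hE : M.E = Set.univ) (L : Set (Fin n)) :
    rk M.dual Lᶜ = rk M L + (n - L.ncard) - rk M Set.univ := by
  have h1 := rk_dual hE Lᶜ
  have h2 := Set.ncard_add_ncard_compl L
  rw [compl_compl] at h1
  simp only [Nat.card_eq_fintype_card, Fintype.card_fin] at h2
  omega

end DualStructure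

/-! ### Transport of the locked structure along isomorphisms. -/

section Transport

variable {α : Type*} [Finite α] {M N : Matroid α} {φ : Equiv.Perm α}

/-- A permutation matching the bases identifies `N` with `M.map φ`, and mapping preserves ranks. -/
theorem rk_image (hM : M.E = Set.univ) (hN : N.E = Set.univ)
    (hφ : ∀ B, M.IsBase B ↔ N.IsBase (φ '' B)) (X : Set α) : rk N (φ '' X) = rk M X := by
  have h : N = M.map φ φ.injective.injOn := by
    refine Matroid.ext_isBase (by simp [hM, hN]) fun B _ => ?_
    rw [Matroid.map_isBase_iff]
    constructor
    · intro hB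
      refine ⟨φ.symm '' B, (hφ _).mpr (by rwa [Equiv.image_symm_image]), ?_⟩
      rw [Equiv.image_symm_image]
    · rintro ⟨B₀, hB₀, rfl⟩
      exact (hφ _).mp hB₀
  have h1 := M.eRk_map (f := φ) φ.injective.injOn (X := X) (by simp [hM])
  rw [← h, ← cast_rk, ← cast_rk] at h1
  exact_mod_cast h1

theorem rk_dual_image (hM : M.E = Set.univ) (hN : N.E = Set.univ)
    (hr : ∀ X, rk N (φ '' X) = rk M X) (X : Set α) :
    rk N.dual (φ '' X) = rk M.dual X := by
  have h1 := rk_dual hM X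
  have h2 := rk_dual hN (φ '' X)
  have h3 := hr Set.univ
  rw [Set.image_univ_of_surjective φ.surjective] at h3
  rw [← Set.image_compl_eq φ.bijective, hr, Set.ncard_image_of_injective _ φ.injective] at h2
  omega

/-- Expressing parallelism by ranks alone makes the transport lemmas depend only on preservation of
rank, so that they apply to the dual matroids too. -/
theorem mem_parallelClosure_iff_rk (hM : M.E = Set.univ) {e f : α} :
    f ∈ parallelClosure M e ↔
      f = e ∨ (rk M {e, f} = 1 ∧ rk M {e} = 1 ∧ rk M {f} = 1) := by
  unfold parallelClosure
  simp only [hM, Set.mem_univ, true_and, Set.mem_ofPred_eq]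
  by_cases hef : f = e
  · simp [hef]
  · simp only [hef, false_or]
    rw [Matroid.isCircuit_iff_dep_forall_sdiff_singleton_indep,
      ← Matroid.not_indep_iff (by simp [hM])]
    simp only [Set.mem_insert_iff, Set.mem_singleton_iff, forall_eq_or_imp, forall_eq,
      Set.pair_sdiff_left (Ne.symm hef), Set.pair_sdiff_right (Ne.symm hef), indep_iff_rk,
      Set.ncard_pair (Ne.symm hef), Set.ncard_singleton]
    have h1 := rk_le_ncard M {e, f}
    rw [Set.ncard_pair (Ne.symm hef)] at h1
    have h2 := rk_mono M (show {e} ⊆ ({e, f} : Set α) by simp)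
    omega

theorem image_parallelClosure (hM : M.E = Set.univ) (hN : N.E = Set.univ)
    (hr : ∀ X, rk N (φ '' X) = rk M X) (e : α) :
    φ '' parallelClosure M e = parallelClosure N (φ e) := by
  ext f
  obtain ⟨f, rfl⟩ := φ.surjective f
  rw [φ.injective.mem_set_image, mem_parallelClosure_iff_rk hM, mem_parallelClosure_iff_rk hN,
    ← Set.image_pair, ← Set.image_singleton, ← Set.image_singleton, hr, hr, hr]
  simp

theorem image_mem_parallelClosures (hM : M.E = Set.univ) (hN : N.E = Set.univ)
    (hr : ∀ X, rk N (φ '' X) = rk M X) (X : Set α) :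
    φ '' X ∈ parallelClosures N ↔ X ∈ parallelClosures M := by
  unfold parallelClosures
  simp only [hM, hN, Set.mem_univ, true_and, Set.mem_ofPred_eq]
  refine φ.surjective.exists.trans ?_
  simp only [← image_parallelClosure hM hN hr, φ.injective.image_injective.eq_iff]

theorem image_mem_lockedSets (hM : M.E = Set.univ) (hN : N.E = Set.univ)
    (hr : ∀ X, rk N (φ '' X) = rk M X) (X : Set α) :
    φ '' X ∈ lockedSets N ↔ X ∈ lockedSets M := by
  have hrd := rk_dual_image hM hN hr
  have hforall : ∀ p : Set α → Prop, (∀ X, p X) ↔ ∀ X, p (φ '' X) := fun p =>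
    ⟨fun h X => h _, fun h X => by have := h (φ.symm '' X); rwa [Equiv.image_symm_image] at this⟩
  simp only [lockedSets, IsLocked, Set.mem_ofPred_eq, twoConnected_restrict_iff, hM, hN,
    ← Set.compl_eq_univ_sdiff, ← Set.image_compl_eq φ.bijective, ← cast_rk, hr, hrd,
    Set.subset_univ, true_and]
  refine and_congr ?_ (and_congr ?_ Iff.rfl)
  · rw [hforall]
    simp only [Set.image_subset_image_iff φ.injective, Set.image_nonempty,
      ← Set.image_sdiff φ.injective, hr]
  · rw [hforall]
    simp only [Set.image_subset_image_iff φ.injective, Set.image_nonempty,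
      ← Set.image_sdiff φ.injective, hrd]

end Transport

/-! ### Weighted incidence graphs and matroid isomorphism. -/

section CoreGraph

variable {n : ℕ}

/-- The listed sets of the locked structure: parallel closures, coparallel closures and locked
sets. -/
abbrev Listed (M : Matroid (Fin n)) : Type :=
  parallelClosures M ⊕ coparallelClosures M ⊕ lockedSets M

/-- The underlying set of a member of the locked structure. -/
def Listed.set {M : Matroid (Fin n)} : Listed M → Set (Fin n)
  | .inl P => P.1
  | .inr (.inl S) => S.1
  | .inr (.inr L) => L.1

/-- A weight from which the class of the set, and the rank of a locked set, can be recovered. -/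
noncomputable def Listed.weight {M : Matroid (Fin n)} : Listed M → ℕ
  | .inl _ => n + 3
  | .inr (.inl _) => n + 4
  | .inr (.inr L) => n + 5 + rk M L.1

/-- Adjacency of the incidence graph of the locked structure. -/
def incAdj (M : Matroid (Fin n)) : Fin n ⊕ Listed M → Fin n ⊕ Listed M → Prop
  | .inl e, .inr q => e ∈ q.set
  | .inr q, .inl e => e ∈ q.set
  | _, _ => False

/-- The incidence graph between the elements and the sets of the locked structure. -/
def incGraph (M : Matroid (Fin n)) : SimpleGraph (Fin n ⊕ Listed M) where
  Adj := incAdj M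
  symm := ⟨by rintro (e | q) (f | q') h <;> exact h⟩
  loopless := ⟨by rintro (e | q) h <;> exact h⟩

/-- Weights of the vertices of the incidence graph; the weight of the elements gives the rank. -/
noncomputable def incWeight (M : Matroid (Fin n)) : Fin n ⊕ Listed M → ℕ
  | .inl _ => 2 + rk M Set.univ
  | .inr q => q.weight

theorem rk_le (M : Matroid (Fin n)) (X : Set (Fin n)) : rk M X ≤ n := by
  have h := (rk_le_ncard M X).trans (Set.ncard_le_card X)
  simpa using h

theorem two_le_incWeight (M : Matroid (Fin n)) (v) : 2 ≤ incWeight M v := by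
  rcases v with e | P | S | L <;> simp only [incWeight, Listed.weight] <;> omega

theorem incWeight_le (M : Matroid (Fin n)) (v) : incWeight M v ≤ 2 * n + 5 := by
  have := rk_le M
  rcases v with e | P | S | L <;> simp only [incWeight, Listed.weight]
  · have := this Set.univ; omega
  · omega
  · omega
  · have := this L.1; omega

/-- The characterization of bases in a form mentioning the listed sets only through their weights
and elements, which a weighted isomorphism preserves. The weights `n + 3`, `n + 4` and `n + 5 + k`
never collide. -/
theorem isBase_iff_listed {M : Matroid (Fin n)} (hE : M.E = Set.univ) (hM : TwoConnected M)
    (B : Set (Fin n)) :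
    M.IsBase B ↔ B.ncard = rk M Set.univ ∧ ∀ q : Listed M,
      (q.weight = n + 3 → (B ∩ q.set).ncard ≤ 1) ∧ (q.weight = n + 4 → (q.set \ B).ncard ≤ 1) ∧
      ∀ k, q.weight = n + 5 + k → (B ∩ q.set).ncard ≤ k := by
  rw [isBase_iff_locked hE hM]
  refine and_congr Iff.rfl ?_
  constructor
  · rintro ⟨hP, hS, hL⟩ (q | q | q)
    · have := hP q.1 q.2
      simp only [Listed.weight, Listed.set]
      refine ⟨fun _ => this, fun h => by omega, fun k h => by omega⟩
    · have := hS q.1 q.2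
      simp only [Listed.weight, Listed.set]
      refine ⟨fun h => by omega, fun _ => this, fun k h => by omega⟩
    · have := hL q.1 q.2
      simp only [Listed.weight, Listed.set]
      refine ⟨fun h => by omega, fun h => by omega, fun k h => by omega⟩
  · intro h
    exact ⟨fun P hP => (h (.inl ⟨P, hP⟩)).1 rfl, fun S hS => (h (.inr (.inl ⟨S, hS⟩))).2.1 rfl,
      fun L hL => (h (.inr (.inr ⟨L, hL⟩))).2.2 _ rfl⟩

/-- An isomorphism of matroids induces a weighted isomorphism of their incidence graphs. -/
theorem exists_incGraph_iso {M N : Matroid (Fin n)} (hM : M.E = Set.univ) (hN : N.E = Set.univ)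
    {φ : Equiv.Perm (Fin n)} (hφ : ∀ B, M.IsBase B ↔ N.IsBase (φ '' B)) :
    ∃ f : incGraph M ≃g incGraph N, ∀ v, incWeight N (f v) = incWeight M v := by
  have hr := rk_image hM hN hφ
  have hrd := rk_dual_image hM hN hr
  let ψ : Listed M ≃ Listed N :=
    Equiv.sumCongr
      ((Equiv.Set.congr φ).subtypeEquiv fun X => (image_mem_parallelClosures hM hN hr X).symm)
      (Equiv.sumCongr
        ((Equiv.Set.congr φ).subtypeEquiv fun X =>
          (image_mem_parallelClosures (M := M.dual) (N := N.dual) hM hN hrd X).symm)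
        ((Equiv.Set.congr φ).subtypeEquiv fun X => (image_mem_lockedSets hM hN hr X).symm))
  have hψ : ∀ q, (ψ q).set = φ '' q.set := by rintro (q | q | q) <;> rfl
  have hmem : ∀ e q, φ e ∈ (ψ q).set ↔ e ∈ q.set := fun e q => by
    rw [hψ, φ.injective.mem_set_image]
  refine ⟨⟨Equiv.sumCongr φ ψ, ?_⟩, ?_⟩
  · rintro (e | q) (f | q')
    · exact Iff.rfl
    · exact hmem e q'
    · exact hmem f q
    · exact Iff.rfl
  · rintro (e | q | q | q)
    · have := hr Set.univ
      rw [Set.image_univ_of_surjective φ.surjective] at this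
      exact congrArg (2 + ·) this
    · rfl
    · rfl
    · exact congrArg (n + 5 + ·) (hr q.1)

/-- A weighted isomorphism of the incidence graphs of two 2-connected matroids gives an isomorphism
of the matroids. -/
theorem exists_perm_of_incGraph_iso {M N : Matroid (Fin n)} (hM : M.E = Set.univ)
    (hN : N.E = Set.univ) (hM2 : TwoConnected M) (hN2 : TwoConnected N)
    (f : incGraph M ≃g incGraph N) (hf : ∀ v, incWeight N (f v) = incWeight M v) :
    ∃ φ : Equiv.Perm (Fin n), ∀ B, M.IsBase B ↔ N.IsBase (φ '' B) := by
  -- Elements weigh at most `n + 2` and sets at least `n + 3`, so the isomorphism cannot mix the two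
  -- sides.
  have hel : ∀ {N : Matroid (Fin n)} (e : Fin n), incWeight N (.inl e) < n + 3 := fun {N} e => by
    have := rk_le N Set.univ
    simp only [incWeight]; omega
  have hse : ∀ {N : Matroid (Fin n)} (q : Listed N), n + 3 ≤ incWeight N (.inr q) := fun {N} q => by
    rcases q with q | q | q <;> simp only [incWeight, Listed.weight] <;> omega
  have h1 : ∀ e, ∃ e', f (.inl e) = .inl e' := by
    intro e
    rcases h : f (.inl e) with e' | q
    · exact ⟨e', rfl⟩
    · have h2 := hf (.inl e)
      rw [h] at h2
      have := hel (N := M) e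
      have := hse q
      omega
  have h2 : ∀ q, ∃ q', f (.inr q) = .inr q' := by
    intro q
    rcases h : f (.inr q) with e' | q'
    · have h2 := hf (.inr q)
      rw [h] at h2
      have := hel (N := N) e'
      have := hse q
      omega
    · exact ⟨q', rfl⟩
  choose φ hφ using h1
  choose ψ hψ using h2
  have hinj : Function.Injective φ := fun a b h => by
    have : f (.inl a) = f (.inl b) := by rw [hφ, hφ, h]
    simpa using f.injective this
  have hψs : Function.Surjective ψ := by
    intro q
    obtain ⟨v, hv⟩ := f.surjective (.inr q)
    rcases v with e | q'
    · rw [hφ] at hv; cases hv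
    · rw [hψ] at hv; exact ⟨q', by simpa using hv⟩
  let φ' : Equiv.Perm (Fin n) := Equiv.ofBijective φ (Finite.injective_iff_bijective.mp hinj)
  have hset : ∀ q, (ψ q).set = φ' '' q.set := by
    intro q
    ext e
    obtain ⟨e, rfl⟩ := φ'.surjective e
    rw [φ'.injective.mem_set_image]
    have := f.map_adj_iff (v := .inl e) (w := .inr q)
    rw [hφ, hψ] at this
    exact this
  have hwt : ∀ q, (ψ q).weight = q.weight := by
    intro q
    have := hf (.inr q)
    rw [hψ] at this
    exact this
  have hrk : rk M Set.univ = rk N Set.univ := by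
    -- Without elements no weight records the rank, but both ranks are then 0.
    rcases n with _ | n
    · have := rk_le M Set.univ
      have := rk_le N Set.univ
      omega
    · have := hf (.inl 0)
      rw [hφ] at this
      simp only [incWeight] at this
      omega
  refine ⟨φ', fun B => ?_⟩
  rw [isBase_iff_listed hM hM2, isBase_iff_listed hN hN2, hψs.forall]
  simp only [hset, hwt, ← Set.image_inter φ'.injective, ← Set.image_sdiff φ'.injective,
    Set.ncard_image_of_injective _ φ'.injective, hrk]

theorem selfDual_iff_incGraph {M : Matroid (Fin n)} (hE : M.E = Set.univ) (hM : TwoConnected M) :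
    SelfDual M ↔
      ∃ f : incGraph M ≃g incGraph M.dual, ∀ v, incWeight M.dual (f v) = incWeight M v := by
  have hEd : M.dual.E = Set.univ := hE
  constructor
  · rintro ⟨φ, -, hφ⟩
    exact exists_incGraph_iso hE hEd hφ
  · rintro ⟨f, hf⟩
    obtain ⟨φ, hφ⟩ := exists_perm_of_incGraph_iso hE hEd hM (twoConnected_dual hE hM) f hf
    exact ⟨φ, by rw [hE, Set.image_univ_of_surjective φ.surjective], hφ⟩

end CoreGraph

/-! ### Encoding vertex weights by pendant vertices. -/

section Pendant

variable {V V' : Type*}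

/-- The graph `C` with `w v` pendant vertices attached to each vertex `v`, and isolated vertices
added so that the vertex set is `V × Fin (W + 1)`. -/
def pendantGraph (C : SimpleGraph V) (w : V → ℕ) (W : ℕ) : SimpleGraph (V × Fin (W + 1)) where
  Adj x y := (x.2.val = 0 ∧ y.2.val = 0 ∧ C.Adj x.1 y.1) ∨ (x.1 = y.1 ∧
    ((x.2.val = 0 ∧ 1 ≤ y.2.val ∧ y.2.val ≤ w x.1) ∨ (y.2.val = 0 ∧ 1 ≤ x.2.val ∧ x.2.val ≤ w x.1)))
  symm := ⟨by
    rintro ⟨v, i⟩ ⟨v', j⟩ (⟨h1, h2, h3⟩ | ⟨rfl, h⟩)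
    · exact Or.inl ⟨h2, h1, h3.symm⟩
    · exact Or.inr ⟨rfl, h.symm⟩⟩
  loopless := ⟨by
    rintro ⟨v, i⟩ (⟨_, _, h⟩ | ⟨_, h⟩)
    · exact C.loopless.irrefl _ h
    · omega⟩

/-- A vertex with at least two neighbours. -/
def IsCore {V : Type*} (G : SimpleGraph V) (x : V) : Prop := ∃ y z, y ≠ z ∧ G.Adj x y ∧ G.Adj x z

theorem isCore_iso {G : SimpleGraph V} {H : SimpleGraph V'} (f : G ≃g H) (x : V) :
    IsCore H (f x) ↔ IsCore G x := by
  unfold IsCore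
  refine f.surjective.exists.trans (exists_congr fun y => f.surjective.exists.trans ?_)
  simp only [f.map_adj_iff, f.injective.ne_iff]

variable {C : SimpleGraph V} {w : V → ℕ} {C' : SimpleGraph V'} {w' : V' → ℕ} {W : ℕ}

/-- A vertex off level 0 has at most the neighbour below it, while a vertex on level 0 has its first
two pendants. This is where `2 ≤ w v` matters: the core becomes invariant under isomorphism. -/
theorem isCore_pendantGraph (hw : ∀ v, 2 ≤ w v) (hW : ∀ v, w v ≤ W) (x : V × Fin (W + 1)) :
    IsCore (pendantGraph C w W) x ↔ x.2.val = 0 := by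
  obtain ⟨v, i⟩ := x
  constructor
  · rintro ⟨⟨a, j⟩, ⟨b, k⟩, hne, h1, h2⟩
    simp only [pendantGraph] at h1 h2 ⊢
    by_contra hi
    have e1 : v = a ∧ j.val = 0 := by
      rcases h1 with ⟨h, _⟩ | ⟨h, h' | h'⟩
      · exact absurd h hi
      · exact absurd h'.1 hi
      · exact ⟨h, h'.1⟩
    have e2 : v = b ∧ k.val = 0 := by
      rcases h2 with ⟨h, _⟩ | ⟨h, h' | h'⟩
      · exact absurd h hi
      · exact absurd h'.1 hi
      · exact ⟨h, h'.1⟩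
    exact hne (Prod.ext (e1.1.symm.trans e2.1) (Fin.ext (e1.2.trans e2.2.symm)))
  · intro hi
    have h2 := hw v
    have h3 := hW v
    refine ⟨(v, ⟨1, by omega⟩), (v, ⟨2, by omega⟩), by simp, ?_, ?_⟩
    · exact Or.inr ⟨rfl, Or.inl ⟨hi, le_rfl, by simp only; omega⟩⟩
    · exact Or.inr ⟨rfl, Or.inl ⟨hi, by simp, by simp only; omega⟩⟩

theorem pendantGraph_adj_zero {a b : V} :
    (pendantGraph C w W).Adj (a, 0) (b, 0) ↔ C.Adj a b := by
  simp [pendantGraph]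

/-- The weight of a core vertex is recovered as an isomorphism invariant. -/
theorem ncard_pendants (hw : ∀ v, 2 ≤ w v) (hW : ∀ v, w v ≤ W) (v : V) :
    {y | (pendantGraph C w W).Adj (v, 0) y ∧ ¬ IsCore (pendantGraph C w W) y}.ncard = w v := by
  have : {y | (pendantGraph C w W).Adj (v, 0) y ∧ ¬ IsCore (pendantGraph C w W) y} =
      (fun j : Fin (W + 1) => (v, j)) '' {j | 1 ≤ j.val ∧ j.val ≤ w v} := by
    ext ⟨a, j⟩
    simp only [Set.mem_ofPred_eq, isCore_pendantGraph hw hW, Set.mem_image, Prod.mk.injEq]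
    simp only [pendantGraph, Fin.val_zero, true_and]
    constructor
    · rintro ⟨⟨h, _⟩ | ⟨rfl, h⟩, h'⟩
      · exact absurd h h'
      · exact ⟨j, by omega, rfl, rfl⟩
    · rintro ⟨j, h, rfl, rfl⟩
      exact ⟨Or.inr ⟨rfl, Or.inl h⟩, by omega⟩
  rw [this, Set.ncard_image_of_injective _ (fun i j h => by simpa using h)]
  have h2 : Fin.val '' {j : Fin (W + 1) | 1 ≤ j.val ∧ j.val ≤ w v} = Set.Icc 1 (w v) := by
    ext j
    simp only [Set.mem_image, Set.mem_ofPred_eq, Set.mem_Icc]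
    constructor
    · rintro ⟨i, h, rfl⟩
      exact h
    · intro h
      exact ⟨⟨j, by have := hW v; omega⟩, h, rfl⟩
  rw [← Set.ncard_image_of_injective _ Fin.val_injective, h2, Set.ncard_eq_toFinset_card']
  simp

/-- Pendant graphs are isomorphic exactly if there is a weighted isomorphism of the cores. -/
theorem nonempty_pendantGraph_iso_iff (hw : ∀ v, 2 ≤ w v) (hW : ∀ v, w v ≤ W)
    (hw' : ∀ v, 2 ≤ w' v) (hW' : ∀ v, w' v ≤ W) :
    Nonempty (pendantGraph C w W ≃g pendantGraph C' w' W) ↔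
      ∃ f : C ≃g C', ∀ v, w' (f v) = w v := by
  constructor
  · rintro ⟨f⟩
    have hcore : ∀ x, (f x).2.val = 0 ↔ x.2.val = 0 := fun x => by
      rw [← isCore_pendantGraph (C := C') hw' hW', isCore_iso f, isCore_pendantGraph hw hW]
    have hcore' : ∀ x, (f.symm x).2.val = 0 ↔ x.2.val = 0 := fun x => by
      rw [← hcore, f.apply_symm_apply]
    have h1 : ∀ v, f (v, 0) = ((f (v, 0)).1, 0) := fun v =>
      Prod.ext rfl (Fin.ext ((hcore (v, 0)).mpr rfl))
    have h2 : ∀ v, f.symm (v, 0) = ((f.symm (v, 0)).1, 0) := fun v =>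
      Prod.ext rfl (Fin.ext ((hcore' (v, 0)).mpr rfl))
    let e : V ≃ V' :=
      { toFun := fun v => (f (v, 0)).1
        invFun := fun v => (f.symm (v, 0)).1
        left_inv := fun v => by
          simp only
          rw [← h1, f.symm_apply_apply]
        right_inv := fun v => by
          simp only
          rw [← h2, f.apply_symm_apply] }
    refine ⟨⟨e, ?_⟩, ?_⟩
    · intro a b
      rw [← pendantGraph_adj_zero (w := w') (W := W), ← pendantGraph_adj_zero (w := w) (W := W),
        ← f.map_adj_iff, h1 a, h1 b]
      rfl
    · intro v
      change w' ((f (v, 0)).1) = w v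
      rw [← ncard_pendants (C := C') hw' hW', ← ncard_pendants (C := C) hw hW v, ← h1,
        ← Set.ncard_image_of_injective _ f.injective]
      congr 1
      ext y
      obtain ⟨y, rfl⟩ := f.surjective y
      rw [f.injective.mem_set_image]
      simp only [Set.mem_ofPred_eq, isCore_iso f, f.map_adj_iff]
  · rintro ⟨f, hf⟩
    refine ⟨⟨Equiv.prodCongr f.toEquiv (Equiv.refl _), ?_⟩⟩
    rintro ⟨v, i⟩ ⟨v', j⟩
    simp only [pendantGraph, Equiv.prodCongr_apply, Prod.map, Equiv.refl_apply]
    have h1 : C'.Adj (f v) (f v') ↔ C.Adj v v' := f.map_adj_iff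
    have h2 : f v = f v' ↔ v = v' := f.injective.eq_iff
    have h3 := hf v
    change (_ ∧ _ ∧ C'.Adj (f v) (f v')) ∨ (f v = f v' ∧ ((_ ∧ _ ∧ _ ≤ w' (f v)) ∨
      (_ ∧ _ ∧ _ ≤ w' (f v)))) ↔ _
    rw [h1, h2, h3]

end Pendant

/-! ### Bounded-sum terms and their compilation -/

/-- `p` runs from `s` to `s'` in at most `T` steps. -/
def Runs (p : Prog) (s : State) (T : ℕ) (s' : State) : Prop := ∃ t ≤ T, Exec p s t s'

theorem Runs.mono {p s T T' s'} (h : Runs p s T s') (hT : T ≤ T') : Runs p s T' s' :=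
  h.imp fun _ h => ⟨h.1.trans hT, h.2⟩

theorem Runs.seq {p q s s₁ s₂ T₁ T₂} (h : Runs p s T₁ s₁) (h' : Runs q s₁ T₂ s₂) :
    Runs (.seq p q) s (T₁ + T₂) s₂ := by
  obtain ⟨t, ht, h⟩ := h
  obtain ⟨t', ht', h'⟩ := h'
  exact ⟨_, add_le_add ht ht', h.seq h'⟩

theorem Runs.const (x a s) : Runs (.const x a) s 1 (s.setReg x a) := ⟨1, le_rfl, .const x a s⟩

theorem Runs.plus (x y z) (s : State) :
    Runs (.plus x y z) s 1 (s.setReg x (s.reg y + s.reg z)) := ⟨1, le_rfl, .plus x y z s⟩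

theorem Runs.minus (x y z) (s : State) :
    Runs (.minus x y z) s 1 (s.setReg x (s.reg y - s.reg z)) := ⟨1, le_rfl, .minus x y z s⟩

theorem Runs.load (x a y) (s : State) :
    Runs (.load x a y) s 1 (s.setReg x (s.mem a (s.reg y))) := ⟨1, le_rfl, .load x a y s⟩

theorem Runs.emit (x) (s : State) :
    Runs (.emit x) s 1 { s with out := s.out ++ [s.reg x] } := ⟨1, le_rfl, .emit x s⟩

/-- The counter `x` falls from `k` to 0 while the index of the invariant rises. Each round costs one
extra step for its test, and the final test costs one more. -/
theorem runs_loop {x : ℕ} {p : Prog} {k c : ℕ} (I : ℕ → State → Prop)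
    (hI : ∀ i < k, ∀ s, I i s → ∃ s', Runs p s c s' ∧ I (i + 1) s')
    (hx : ∀ i ≤ k, ∀ s, I i s → s.reg x = k - i) (s : State) (h0 : I 0 s) :
    ∃ s', Runs (.loop x p) s (k * (c + 1) + 1) s' ∧ I k s' := by
  suffices h : ∀ j ≤ k, ∀ s, I (k - j) s →
      ∃ s', Runs (.loop x p) s (j * (c + 1) + 1) s' ∧ I k s' from
    h k le_rfl s (by rwa [Nat.sub_self])
  intro j
  induction j with
  | zero =>
    intro _ s hs
    have := hx k le_rfl s hs
    exact ⟨s, ⟨1, by omega, by constructor; omega⟩, hs⟩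
  | succ j ih =>
    intro hj s hs
    obtain ⟨s₁, ⟨t₁, ht₁, h₁⟩, hs₁⟩ := hI (k - (j + 1)) (by omega) s hs
    rw [show k - (j + 1) + 1 = k - j by omega] at hs₁
    obtain ⟨s₂, ⟨t₂, ht₂, h₂⟩, hs₂⟩ := ih (by omega) s₁ hs₁
    have := hx _ (by omega) s hs
    refine ⟨s₂, ⟨t₁ + t₂ + 1, ?_, .loop_step (by omega) h₁ h₂⟩, hs₂⟩
    rw [Nat.succ_mul]
    omega

/-- The registers holding temporary values at depth at least `d`. The other registers of even
index are not used by compiled programs, and those of odd index hold the variables. -/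
def tmp (d : ℕ) : Set ℕ := {r | 2 * d + 2 ≤ r ∧ r % 2 = 0}

theorem mem_tmp {d r : ℕ} : r ∈ tmp d ↔ 2 * d + 2 ≤ r ∧ r % 2 = 0 := Iff.rfl

/-- The states agree in the arrays and in the registers outside `S`. -/
def Same (S : Set ℕ) (s s' : State) : Prop := s'.mem = s.mem ∧ ∀ r ∉ S, s'.reg r = s.reg r

/-- Compiled bounded iteration: `pb` computes the bound, and `p` is run for each value of the
variable `x` below it; the old value of `x` is restored at the end. -/
def forProg (x d : ℕ) (pb p : Prog) : Prog :=
  .seq pb (.seq (.const (2 * d + 4) 1) (.seq (.const (2 * d + 6) 0)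
    (.seq (.plus (2 * d + 6) (2 * d + 6) (2 * x + 1)) (.seq (.const (2 * x + 1) 0)
      (.seq (.loop (2 * d + 2) (.seq p (.seq (.plus (2 * x + 1) (2 * x + 1) (2 * d + 4))
        (.minus (2 * d + 2) (2 * d + 2) (2 * d + 4)))))
        (.seq (.const (2 * x + 1) 0) (.plus (2 * x + 1) (2 * x + 1) (2 * d + 6))))))))

/-- Registers `2d+2`, `2d+4`, `2d+6` hold the countdown, the constant 1 and the saved loop variable;
temporaries of the body start at depth `d + 3`. The set `A` contains registers of smaller depth that
the body may change, such as an accumulator, and `J` may depend only on these and the output. -/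
theorem runs_forProg {x d : ℕ} {pb p : Prog} {s : State} {k cb c : ℕ} (A : Set ℕ)
    (hA : ∀ r ∈ A, r < 2 * d + 2 ∧ r % 2 = 0)
    (hb : ∃ s₁, Runs pb s cb s₁ ∧ Same (tmp d) s s₁ ∧ s₁.out = s.out ∧ s₁.reg (2 * d + 2) = k)
    (J : ℕ → State → Prop)
    (hJ : ∀ i s s', s'.out = s.out → (∀ r ∈ A, s'.reg r = s.reg r) → J i s → J i s')
    (h0 : J 0 s)
    (hp : ∀ i < k, ∀ s', s'.mem = s.mem →
      (∀ r, r ∉ A → r ∉ tmp d → s'.reg r = if r = 2 * x + 1 then i else s.reg r) → J i s' →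
      ∃ s'', Runs p s' c s'' ∧ Same (A ∪ tmp (d + 3)) s' s'' ∧ J (i + 1) s'') :
    ∃ s', Runs (forProg x d pb p) s (cb + k * (c + 3) + 8) s' ∧ Same (A ∪ tmp d) s s' ∧
      J k s' := by
  obtain ⟨s₁, hr₁, ⟨hm₁, hs₁⟩, ho₁, hk₁⟩ := hb
  have hA1 : ∀ r ∈ A, r ∉ tmp d := fun r hr h => by
    have := hA r hr; rw [mem_tmp] at h; omega
  have hAx : ∀ r ∈ A, r ≠ 2 * x + 1 := fun r hr h => by have := hA r hr; omega
  let I : ℕ → State → Prop := fun i s' =>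
    s'.mem = s.mem ∧
    (∀ r, r ∉ A → r ∉ tmp d → s'.reg r = if r = 2 * x + 1 then i else s.reg r) ∧
    s'.reg (2 * d + 2) = k - i ∧ s'.reg (2 * d + 4) = 1 ∧
    s'.reg (2 * d + 6) = s.reg (2 * x + 1) ∧ J i s'
  have hbody : ∀ i < k, ∀ s', I i s' → ∃ s'', Runs (.seq p (.seq (.plus (2 * x + 1) (2 * x + 1)
      (2 * d + 4)) (.minus (2 * d + 2) (2 * d + 2) (2 * d + 4)))) s' (c + (1 + 1)) s'' ∧
      I (i + 1) s'' := by
    rintro i hi s' ⟨h1, h2, h3, h4, h5, h6⟩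
    obtain ⟨s'', hr, ⟨hm, hs⟩, hj⟩ := hp i hi s' h1 h2 h6
    have hs' : ∀ r, r ∉ A → r < 2 * d + 8 ∨ r % 2 = 1 → s''.reg r = s'.reg r := by
      intro r hr hr'
      refine hs r ?_
      rintro (h | h)
      · exact hr h
      · rw [mem_tmp] at h; omega
    have hAn : ∀ r, 2 * d + 2 ≤ r ∨ r % 2 = 1 → r ∉ A := fun r hr h => by
      have := hA r h; omega
    refine ⟨_, hr.seq ((Runs.plus _ _ _ _).seq (Runs.minus _ _ _ _)), ?_, ?_, ?_, ?_, ?_, ?_⟩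
    · exact hm.trans h1
    · intro r hrA hrT
      simp only [State.setReg, Function.update_apply]
      have e1 : r ≠ 2 * d + 2 := fun h => hrT (by rw [mem_tmp]; omega)
      rw [if_neg e1]
      split_ifs with h
      · rw [hs' _ (hAn _ (by omega)) (by omega), hs' _ (hAn _ (by omega)) (by omega), h4,
          h2 _ (hAn _ (by omega)) (by rw [mem_tmp]; omega), if_pos rfl]
      · rw [hs r (by
          rintro (h | h)
          · exact hrA h
          · exact hrT (by rw [mem_tmp] at h ⊢; omega)), h2 r hrA hrT, if_neg h]
    · simp only [State.setReg, Function.update_apply]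
      rw [if_true, if_neg (by omega), if_neg (by omega), hs' _ (hAn _ (by omega)) (by omega),
        hs' _ (hAn _ (by omega)) (by omega), h3, h4]
      omega
    · simp only [State.setReg, Function.update_apply]
      rw [if_neg (by omega), if_neg (by omega), hs' _ (hAn _ (by omega)) (by omega), h4]
    · simp only [State.setReg, Function.update_apply]
      rw [if_neg (by omega), if_neg (by omega), hs' _ (hAn _ (by omega)) (by omega), h5]
    · refine hJ _ s'' _ rfl (fun r hr => ?_) hj
      have := hA r hr
      simp only [State.setReg, Function.update_apply]
      rw [if_neg (by omega), if_neg (by omega)]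
  let s₂ := (((s₁.setReg (2 * d + 4) 1).setReg (2 * d + 6) 0).setReg (2 * d + 6)
    (s₁.reg (2 * x + 1))).setReg (2 * x + 1) 0
  have hI0 : I 0 s₂ := by
    have hx1 : s₁.reg (2 * x + 1) = s.reg (2 * x + 1) := hs₁ _ (by rw [mem_tmp]; omega)
    refine ⟨hm₁, ?_, ?_, ?_, ?_, ?_⟩
    · intro r hrA hrT
      have e1 : r ≠ 2 * d + 4 := fun h => hrT (by rw [mem_tmp]; omega)
      have e2 : r ≠ 2 * d + 6 := fun h => hrT (by rw [mem_tmp]; omega)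
      simp only [s₂, State.setReg, Function.update_apply, e1, e2, if_false, hs₁ r hrT]
    · simp only [s₂, State.setReg, Function.update_apply]
      rw [if_neg (by omega), if_neg (by omega), if_neg (by omega), if_neg (by omega), hk₁]
      rfl
    · simp only [s₂, State.setReg, Function.update_apply]
      rw [if_neg (by omega), if_neg (by omega), if_neg (by omega), if_true]
    · simp only [s₂, State.setReg, Function.update_apply]
      rw [if_neg (by omega), if_true, hx1]
    · refine hJ _ s _ ho₁ (fun r hr => ?_) h0
      have := hA r hr
      simp only [s₂, State.setReg, Function.update_apply]
      rw [if_neg (by omega), if_neg (by omega), if_neg (by omega), if_neg (by omega)]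
      exact hs₁ r (hA1 r hr)
  obtain ⟨s₃, hr₃, hm₃, hs₃, -, -, h6, hj₃⟩ := runs_loop I hbody (fun i _ s' h => h.2.2.1) s₂ hI0
  refine ⟨((s₃.setReg (2 * x + 1) 0).setReg (2 * x + 1) (s.reg (2 * x + 1))), ?_, ⟨hm₃, ?_⟩, ?_⟩
  · have hplus : Runs (.plus (2 * d + 6) (2 * d + 6) (2 * x + 1))
        ((s₁.setReg (2 * d + 4) 1).setReg (2 * d + 6) 0) 1
        (((s₁.setReg (2 * d + 4) 1).setReg (2 * d + 6) 0).setReg (2 * d + 6)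
          (s₁.reg (2 * x + 1))) := by
      convert Runs.plus _ _ _ _ using 2
      simp only [State.setReg, Function.update_apply]
      rw [if_true, if_neg (by omega), if_neg (by omega), zero_add]
    have hplus' : Runs (.plus (2 * x + 1) (2 * x + 1) (2 * d + 6)) (s₃.setReg (2 * x + 1) 0) 1
        ((s₃.setReg (2 * x + 1) 0).setReg (2 * x + 1) (s.reg (2 * x + 1))) := by
      convert Runs.plus _ _ _ _ using 2
      simp only [State.setReg, Function.update_apply]
      rw [if_true, if_neg (by omega), h6, zero_add]
    refine (hr₁.seq ((Runs.const _ _ _).seq ((Runs.const _ _ _).seq (hplus.seq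
      ((Runs.const _ _ _).seq (hr₃.seq ((Runs.const _ _ _).seq hplus'))))))).mono ?_
    rw [show c + (1 + 1) + 1 = c + 3 by ring]
    omega
  · intro r hr
    simp only [State.setReg, Function.update_apply]
    split_ifs with h
    · rw [h]
    · rw [hs₃ r (fun h => hr (Or.inl h)) (fun h => hr (Or.inr h)), if_neg h]
  · refine hJ _ s₃ _ rfl (fun r hr => ?_) hj₃
    simp only [State.setReg, Function.update_apply, hAx r hr, if_false]

/-- Arithmetic terms over variables, with access to the input word and with bounded sums. -/
inductive Term : Type
  | const (a : ℕ)
  | var (x : ℕ)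
  | add (a b : Term)
  | sub (a b : Term)
  | inp (a : Term)
  | sum (x : ℕ) (b a : Term)

/-- The value of a term on the input `m` under an assignment of the variables. -/
def Term.eval (m : ℕ → ℕ) : Term → (ℕ → ℕ) → ℕ
  | .const a, _ => a
  | .var x, env => env x
  | .add a b, env => a.eval m env + b.eval m env
  | .sub a b, env => a.eval m env - b.eval m env
  | .inp a, env => m (a.eval m env)
  | .sum x b a, env => ∑ i ∈ Finset.range (b.eval m env), a.eval m (Function.update env x i)

/-- A program leaving the value of the term in the first temporary register of depth `d`. -/
def Term.compile : Term → ℕ → Prog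
  | .const a, d => .const (2 * d + 2) a
  | .var x, d => .seq (.const (2 * d + 2) 0) (.plus (2 * d + 2) (2 * d + 2) (2 * x + 1))
  | .add a b, d => .seq (a.compile d) (.seq (b.compile (d + 1))
      (.plus (2 * d + 2) (2 * d + 2) (2 * d + 4)))
  | .sub a b, d => .seq (a.compile d) (.seq (b.compile (d + 1))
      (.minus (2 * d + 2) (2 * d + 2) (2 * d + 4)))
  | .inp a, d => .seq (a.compile d) (.load (2 * d + 2) 0 (2 * d + 2))
  | .sum x b a, d => .seq (.const (2 * d + 2) 0) (forProg x (d + 1) (b.compile (d + 1))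
      (.seq (a.compile (d + 4)) (.plus (2 * d + 2) (2 * d + 2) (2 * d + 10))))

/-- A bound for the value of a term in terms of a bound for the variables and the input. -/
noncomputable def Term.valueBound : Term → Polynomial ℕ
  | .const a => Polynomial.C a
  | .var _ => Polynomial.X
  | .add a b => a.valueBound + b.valueBound
  | .sub a _ => a.valueBound
  | .inp _ => Polynomial.X
  | .sum _ b a => b.valueBound * a.valueBound.comp (Polynomial.X + b.valueBound)

/-- A bound for the number of steps of the compiled program. -/
noncomputable def Term.timeBound : Term → Polynomial ℕ
  | .const _ => 1
  | .var _ => 2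
  | .add a b => a.timeBound + b.timeBound + 1
  | .sub a b => a.timeBound + b.timeBound + 1
  | .inp a => a.timeBound + 1
  | .sum _ b a =>
    b.timeBound + b.valueBound * (a.timeBound.comp (Polynomial.X + b.valueBound) + 4) + 9

/-- Inside a sum the index stays below the upper limit, so `B` is replaced by `B` plus a bound for
that limit; composing polynomials accounts for this. -/
theorem Term.eval_le {m : ℕ → ℕ} (a : Term) {B : ℕ} {env : ℕ → ℕ} (hm : ∀ i, m i ≤ B)
    (henv : ∀ x, env x ≤ B) : a.eval m env ≤ a.valueBound.eval B := by
  induction a generalizing B env with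
  | const a => simp [Term.eval, Term.valueBound]
  | var x => simpa [Term.eval, Term.valueBound] using henv x
  | add a b iha ihb =>
    simpa [Term.eval, Term.valueBound] using add_le_add (iha hm henv) (ihb hm henv)
  | sub a b iha _ => exact (Nat.sub_le _ _).trans (iha hm henv)
  | inp a _ => simpa [Term.eval, Term.valueBound] using hm _
  | sum x b a ihb iha =>
    simp only [Term.eval, Term.valueBound, Polynomial.eval_mul, Polynomial.eval_comp,
      Polynomial.eval_add, Polynomial.eval_X]
    have hb := ihb hm henv
    refine (Finset.sum_le_card_nsmul _ _ (a.valueBound.eval (B + b.valueBound.eval B)) ?_).trans ?_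
    · intro i hi
      have := Finset.mem_range.mp hi
      refine iha (fun j => (hm j).trans (Nat.le_add_right _ _)) fun y => ?_
      rw [Function.update_apply]
      split_ifs
      · omega
      · exact (henv y).trans (Nat.le_add_right _ _)
    · rw [Finset.card_range, smul_eq_mul]
      exact Nat.mul_le_mul_right _ hb

/-- The assignment of the variables in a state. -/
def State.env (s : State) : ℕ → ℕ := fun x => s.reg (2 * x + 1)

theorem Same.env {d : ℕ} {s s' : State} (h : Same (tmp d) s s') : s'.env = s.env := by
  funext x
  exact h.2 _ (by rw [mem_tmp]; omega)

theorem Same.trans {S S' : Set ℕ} {s s' s'' : State} (h : Same S s s') (h' : Same S' s' s'')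
    (hS : S' ⊆ S) : Same S s s'' :=
  ⟨h'.1.trans h.1, fun r hr => (h'.2 r fun h => hr (hS h)).trans (h.2 r hr)⟩

theorem Same.setReg {S : Set ℕ} {s s' : State} (h : Same S s s') {x v : ℕ} (hx : x ∈ S) :
    Same S s (s'.setReg x v) := by
  refine ⟨h.1, fun r hr => ?_⟩
  have : r ≠ x := fun h => hr (h ▸ hx)
  simp only [State.setReg, Function.update_apply, this, if_false]
  exact h.2 r hr

theorem Same.refl (S : Set ℕ) (s : State) : Same S s s := ⟨rfl, fun _ _ => rfl⟩

theorem tmp_mono {d d' : ℕ} (h : d ≤ d') : tmp d' ⊆ tmp d := fun r hr => by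
  rw [mem_tmp] at *; omega

theorem reg_setReg_self (s : State) (x v : ℕ) : (s.setReg x v).reg x = v := by
  simp [State.setReg]

/-- The `Same` clause drives the induction: a value left at depth `d` survives computations at
greater depth, and variables and the input array are unchanged at the end. -/
theorem Term.runs_compile (a : Term) (d : ℕ) {m : ℕ → ℕ} (s : State) {B : ℕ}
    (hsm : s.mem 0 = m) (hm : ∀ i, m i ≤ B) (henv : ∀ x, s.env x ≤ B) :
    ∃ s', Runs (a.compile d) s (a.timeBound.eval B) s' ∧ Same (tmp d) s s' ∧ s'.out = s.out ∧
      s'.reg (2 * d + 2) = a.eval m s.env := by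
  have hmem : ∀ d, 2 * d + 2 ∈ tmp d := fun d => by rw [mem_tmp]; omega
  have hbin : ∀ (a b : Term), (∀ (d : ℕ) (s : State) {B : ℕ}, s.mem 0 = m → (∀ i, m i ≤ B) →
      (∀ x, s.env x ≤ B) → ∃ s', Runs (a.compile d) s (a.timeBound.eval B) s' ∧
        Same (tmp d) s s' ∧ s'.out = s.out ∧ s'.reg (2 * d + 2) = a.eval m s.env) →
      (∀ (d : ℕ) (s : State) {B : ℕ}, s.mem 0 = m → (∀ i, m i ≤ B) →
      (∀ x, s.env x ≤ B) → ∃ s', Runs (b.compile d) s (b.timeBound.eval B) s' ∧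
        Same (tmp d) s s' ∧ s'.out = s.out ∧ s'.reg (2 * d + 2) = b.eval m s.env) →
      ∀ (d : ℕ) (s : State) {B : ℕ}, s.mem 0 = m → (∀ i, m i ≤ B) → (∀ x, s.env x ≤ B) →
      ∃ s₁ s₂, Runs (a.compile d) s (a.timeBound.eval B) s₁ ∧
        Runs (b.compile (d + 1)) s₁ (b.timeBound.eval B) s₂ ∧ Same (tmp d) s s₂ ∧
        s₂.out = s.out ∧ s₂.reg (2 * d + 2) = a.eval m s.env ∧
        s₂.reg (2 * d + 4) = b.eval m s.env := by
    intro a b iha ihb d s B hsm hm henv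
    obtain ⟨s₁, hr₁, hs₁, ho₁, hv₁⟩ := iha d s hsm hm henv
    obtain ⟨s₂, hr₂, hs₂, ho₂, hv₂⟩ := ihb (d + 1) s₁ (by rw [hs₁.1, hsm]) hm
      (by rw [hs₁.env]; exact henv)
    refine ⟨s₁, s₂, hr₁, hr₂, hs₁.trans hs₂ (tmp_mono (Nat.le_succ d)), ho₂.trans ho₁, ?_, ?_⟩
    · rw [hs₂.2 _ (by rw [mem_tmp]; omega), hv₁]
    · rw [← hs₁.env, ← hv₂]
      congr 1
  induction a generalizing d s B with
  | const a =>
    exact ⟨_, (Runs.const _ _ _).mono (by simp [Term.timeBound]),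
      (Same.refl _ s).setReg (hmem d), rfl, reg_setReg_self _ _ _⟩
  | var x =>
    refine ⟨_, ((Runs.const _ _ _).seq (Runs.plus _ _ _ _)).mono (by simp [Term.timeBound]),
      ((Same.refl _ s).setReg (hmem d)).setReg (hmem d), rfl, ?_⟩
    rw [reg_setReg_self, reg_setReg_self]
    simp only [State.setReg, Function.update_apply]
    rw [if_neg (by omega), zero_add]
    rfl
  | add a b iha ihb =>
    obtain ⟨s₁, s₂, h1, h2, hs, ho, hv, hv'⟩ := hbin a b (fun d s _ => iha d s)
      (fun d s _ => ihb d s) d s hsm hm henv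
    refine ⟨_, (h1.seq (h2.seq (Runs.plus _ _ _ _))).mono ?_, hs.setReg (hmem d), ho, ?_⟩
    · simp only [Term.timeBound, Polynomial.eval_add, Polynomial.eval_one]
      omega
    · rw [reg_setReg_self, hv, hv']
      rfl
  | sub a b iha ihb =>
    obtain ⟨s₁, s₂, h1, h2, hs, ho, hv, hv'⟩ := hbin a b (fun d s _ => iha d s)
      (fun d s _ => ihb d s) d s hsm hm henv
    refine ⟨_, (h1.seq (h2.seq (Runs.minus _ _ _ _))).mono ?_, hs.setReg (hmem d), ho, ?_⟩
    · simp only [Term.timeBound, Polynomial.eval_add, Polynomial.eval_one]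
      omega
    · rw [reg_setReg_self, hv, hv']
      rfl
  | inp a iha =>
    obtain ⟨s₁, h1, hs, ho, hv⟩ := iha d s hsm hm henv
    refine ⟨_, (h1.seq (Runs.load _ _ _ _)).mono ?_, hs.setReg (hmem d), ho, ?_⟩
    · simp [Term.timeBound]
    · rw [reg_setReg_self, hv, hs.1, hsm]
      rfl
  | sum x b a ihb iha =>
    have hle := b.eval_le hm henv
    have hacc : Same (tmp d) s (s.setReg (2 * d + 2) 0) := (Same.refl _ s).setReg (hmem d)
    -- Register `2d+2` accumulates the sum. The loop works at depth `d + 1`, its body at depth `d +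
    -- 4`, so each summand appears in register `2d+10`.
    obtain ⟨s₁, hr₁, hs₁, ho₁, hv₁⟩ := runs_forProg (x := x) (d := d + 1)
      (p := .seq (a.compile (d + 4)) (.plus (2 * d + 2) (2 * d + 2) (2 * d + 10)))
      (c := a.timeBound.eval (B + b.valueBound.eval B) + 1) {2 * d + 2}
      (by rintro r rfl; omega)
      (ihb (d + 1) (s.setReg (2 * d + 2) 0) hsm hm (by rw [hacc.env]; exact henv))
      (fun i s' => s'.out = s.out ∧ s'.reg (2 * d + 2) =
        ∑ j ∈ Finset.range i, a.eval m (Function.update s.env x j))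
      (by
        rintro i s s' ho hr ⟨h1, h2⟩
        exact ⟨ho.trans h1, (hr _ rfl).trans h2⟩)
      ⟨rfl, by rw [reg_setReg_self, Finset.range_zero, Finset.sum_empty]⟩
      (by
        rw [hacc.env]
        intro i hi s' hm' hs' ⟨hout, hval⟩
        have henv' : s'.env = Function.update s.env x i := by
          funext y
          rw [State.env, hs' _ (by simp only [Set.mem_singleton_iff]; omega)
            (by rw [mem_tmp]; omega), Function.update_apply]
          by_cases hy : y = x
          · rw [if_pos (by omega), if_pos hy]
          · rw [if_neg (by omega), if_neg hy]
            exact congrFun hacc.env y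
        obtain ⟨s'', hr, hs, ho, hv⟩ := iha (d + 4) s' (B := B + b.valueBound.eval B)
          (by rw [hm', ← hsm]; rfl)
          (fun j => (hm j).trans (Nat.le_add_right _ _)) (by
            intro y
            rw [henv', Function.update_apply]
            split_ifs
            · omega
            · exact (henv y).trans (Nat.le_add_right _ _))
        refine ⟨_, hr.seq (Runs.plus _ _ _ _), ?_, ho.trans hout, ?_⟩
        · refine Same.setReg ⟨hs.1, fun r hr => hs.2 r fun h => hr (Or.inr ?_)⟩
            (Or.inl rfl)
          exact h
        · rw [reg_setReg_self, hs.2 _ (by rw [mem_tmp]; omega), hval, Finset.sum_range_succ,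
            ← henv', ← hv]
          rfl)
    refine ⟨s₁, ((Runs.const _ _ _).seq hr₁).mono ?_, ⟨hs₁.1, fun r hr => ?_⟩, ho₁, ?_⟩
    · simp only [Term.timeBound, Polynomial.eval_add, Polynomial.eval_mul, Polynomial.eval_comp,
        Polynomial.eval_X, Polynomial.eval_ofNat]
      have hmul := Nat.mul_le_mul_right (a.timeBound.eval (B + b.valueBound.eval B) + 4) hle
      rw [hacc.env, add_assoc _ 1 3, show 1 + 3 = 4 from rfl]
      omega
    · have h1 : r ∉ ({2 * d + 2} : Set ℕ) ∪ tmp (d + 1) := by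
        rintro (h | h)
        · rw [Set.mem_singleton_iff] at h; exact hr (h ▸ hmem d)
        · exact hr (tmp_mono (Nat.le_succ d) h)
      rw [hs₁.2 r h1]
      exact hacc.2 r hr
    · rw [hv₁, hacc.env]
      rfl

/-! ### Writers: bounded iteration with output. -/

/-- Programs writing the values of terms. -/
inductive Writer : Type
  | emit (a : Term)
  | seq (p q : Writer)
  | iter (x : ℕ) (b : Term) (p : Writer)

/-- The word written on input `m` under an assignment of the variables. -/
def Writer.word (m : ℕ → ℕ) : Writer → (ℕ → ℕ) → List ℕ
  | .emit a, env => [a.eval m env]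
  | .seq p q, env => p.word m env ++ q.word m env
  | .iter x b p, env =>
    (List.range (b.eval m env)).flatMap fun i => p.word m (Function.update env x i)

/-- The machine program for a writer. -/
def Writer.compile : Writer → ℕ → Prog
  | .emit a, d => .seq (a.compile d) (.emit (2 * d + 2))
  | .seq p q, d => .seq (p.compile d) (q.compile d)
  | .iter x b p, d => forProg x d (b.compile d) (p.compile (d + 3))

/-- A bound for the number of steps of the compiled program. -/
noncomputable def Writer.timeBound : Writer → Polynomial ℕ
  | .emit a => a.timeBound + 1
  | .seq p q => p.timeBound + q.timeBound
  | .iter _ b p =>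
    b.timeBound + b.valueBound * (p.timeBound.comp (Polynomial.X + b.valueBound) + 3) + 8

/-- As for terms, but the results accumulate in the output word, so no register plays the part of an
accumulator (`A = ∅`). -/
theorem Writer.runs_compile (p : Writer) (d : ℕ) {m : ℕ → ℕ} (s : State) {B : ℕ}
    (hsm : s.mem 0 = m) (hm : ∀ i, m i ≤ B) (henv : ∀ x, s.env x ≤ B) :
    ∃ s', Runs (p.compile d) s (p.timeBound.eval B) s' ∧ Same (tmp d) s s' ∧
      s'.out = s.out ++ p.word m s.env := by
  induction p generalizing d s B with
  | emit a =>
    obtain ⟨s₁, h1, hs, ho, hv⟩ := a.runs_compile d s hsm hm henv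
    refine ⟨_, (h1.seq (Runs.emit _ _)).mono ?_, hs, ?_⟩
    · simp [Writer.timeBound]
    · simp only [ho, hv]
      rfl
  | seq p q ihp ihq =>
    obtain ⟨s₁, h1, hs₁, ho₁⟩ := ihp d s hsm hm henv
    obtain ⟨s₂, h2, hs₂, ho₂⟩ := ihq d s₁ (by rw [hs₁.1, hsm]) hm (by rw [hs₁.env]; exact henv)
    refine ⟨s₂, (h1.seq h2).mono ?_, hs₁.trans hs₂ subset_rfl, ?_⟩
    · simp [Writer.timeBound]
    · rw [ho₂, ho₁, hs₁.env, List.append_assoc]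
      rfl
  | iter x b p ih =>
    have hle := b.eval_le hm henv
    obtain ⟨s₁, hr₁, hs₁, ho₁⟩ := runs_forProg (x := x) (d := d) (p := p.compile (d + 3))
      (c := p.timeBound.eval (B + b.valueBound.eval B)) ∅ (by simp)
      (b.runs_compile d s hsm hm henv)
      (fun i s' => s'.out = s.out ++ (List.range i).flatMap fun j =>
        p.word m (Function.update s.env x j))
      (fun i s s' ho _ h => ho.trans h) (by simp)
      (by
        intro i hi s' hm' hs' hout
        have henv' : s'.env = Function.update s.env x i := by
          funext y
          rw [State.env, hs' _ (Set.notMem_empty _) (by rw [mem_tmp]; omega),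
            Function.update_apply]
          by_cases hy : y = x
          · rw [if_pos (by omega), if_pos hy]
          · rw [if_neg (by omega), if_neg hy]
            rfl
        obtain ⟨s'', hr, hs, ho⟩ := ih (d + 3) s' (B := B + b.valueBound.eval B)
          (by rw [hm', hsm]) (fun j => (hm j).trans (Nat.le_add_right _ _)) (by
            intro y
            rw [henv', Function.update_apply]
            split_ifs
            · omega
            · exact (henv y).trans (Nat.le_add_right _ _))
        refine ⟨s'', hr, ?_, ?_⟩
        · rwa [Set.empty_union]
        · rw [ho, hout, henv', List.range_succ, List.flatMap_append, List.append_assoc]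
          simp)
    rw [Set.empty_union] at hs₁
    refine ⟨s₁, hr₁.mono ?_, hs₁, ho₁⟩
    simp only [Writer.timeBound, Polynomial.eval_add, Polynomial.eval_mul, Polynomial.eval_comp,
      Polynomial.eval_X, Polynomial.eval_ofNat]
    have hmul := Nat.mul_le_mul_right (p.timeBound.eval (B + b.valueBound.eval B) + 3) hle
    omega

/-- The input word as a function. -/
def inputFun (w : List ℕ) : ℕ → ℕ := fun i => w.getD i 0

/-- Writers run in time polynomial in a bound for the entries of the input word. -/
theorem polyTimeComputable_of_writer {A : InstanceClass} {R : A.Inst → List ℕ → Prop} (p : Writer)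
    (b : Polynomial ℕ) (hb : ∀ x w, A.Code x w → ∀ a ∈ w, a ≤ b.eval (A.size x))
    (hR : ∀ x w, A.Code x w → R x (p.word (inputFun w) fun _ => 0)) :
    PolyTimeComputable A R := by
  refine ⟨p.compile 0, p.timeBound.comp b, fun x w hw => ?_⟩
  have henv : (initState w).env = fun _ => 0 := by
    funext x
    simp [State.env, initState]
  obtain ⟨s, ⟨t, ht, h⟩, -, ho⟩ := p.runs_compile 0 (m := inputFun w) (initState w)
    (B := b.eval (A.size x)) (by funext i; simp [initState, inputFun])
    (by
      intro i
      unfold inputFun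
      rw [List.getD_eq_getElem?_getD]
      rcases h : w[i]? with _ | a
      · simp
      · simpa using hb x w hw a (List.mem_of_getElem? h))
    (by simp [henv])
  refine ⟨t, _, by rwa [Polynomial.eval_comp], ⟨s, h, ho⟩, ?_⟩
  rw [henv]
  simpa [initState] using hR x w hw

/-! ### Derived terms -/

/-- A number above all variables of a term. -/
def Term.fresh : Term → ℕ
  | .const _ => 0
  | .var x => x + 1
  | .add a b => max a.fresh b.fresh
  | .sub a b => max a.fresh b.fresh
  | .inp a => a.fresh
  | .sum x b a => max (x + 1) (max b.fresh a.fresh)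

/-- Guarantees that the summation variables introduced by `Term.mul` and `cardTerm` capture nothing.
-/
theorem Term.eval_update {m : ℕ → ℕ} (a : Term) (env : ℕ → ℕ) {y : ℕ} (hy : a.fresh ≤ y) (i : ℕ) :
    a.eval m (Function.update env y i) = a.eval m env := by
  induction a generalizing env with
  | const a => rfl
  | var x =>
    simp only [Term.fresh] at hy
    simp only [Term.eval, Function.update_apply]
    rw [if_neg (by omega)]
  | add a b iha ihb =>
    simp only [Term.fresh, max_le_iff] at hy
    simp only [Term.eval, iha _ hy.1, ihb _ hy.2]
  | sub a b iha ihb =>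
    simp only [Term.fresh, max_le_iff] at hy
    simp only [Term.eval, iha _ hy.1, ihb _ hy.2]
  | inp a iha => simp only [Term.eval, iha _ hy]
  | sum x b a ihb iha =>
    simp only [Term.fresh, max_le_iff] at hy
    simp only [Term.eval, ihb _ hy.2.1]
    refine Finset.sum_congr rfl fun j _ => ?_
    rw [Function.update_comm (by omega), iha _ hy.2.2]

/-- The product of two terms. -/
def Term.mul (a b : Term) : Term := .sum b.fresh a b

/-- The term `a` if the value of `c` is nonzero, and `b` otherwise. -/
def Term.cond (c a b : Term) : Term :=
  .add (.mul (.sub (.const 1) (.sub (.const 1) c)) a) (.mul (.sub (.const 1) c) b)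

/-- The truth value of `a ≤ b`. -/
def Term.le (a b : Term) : Term := .sub (.const 1) (.sub a b)

/-- The truth value of `a = b`. -/
def Term.eqv (a b : Term) : Term := .mul (.le a b) (.le b a)

section

variable {m : ℕ → ℕ} {env : ℕ → ℕ}

theorem Term.eval_mul (a b : Term) : (a.mul b).eval m env = a.eval m env * b.eval m env := by
  simp only [Term.mul, Term.eval]
  rw [Finset.sum_congr rfl fun i _ => b.eval_update env le_rfl i, Finset.sum_const,
    Finset.card_range, smul_eq_mul]

theorem Term.eval_cond (c a b : Term) : (c.cond a b).eval m env =
    if c.eval m env = 0 then b.eval m env else a.eval m env := by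
  simp only [Term.cond, Term.eval, Term.eval_mul]
  split_ifs with h
  · simp [h]
  · rw [show 1 - c.eval m env = 0 by omega]
    simp

theorem Term.eval_le_term (a b : Term) : (a.le b).eval m env =
    if a.eval m env ≤ b.eval m env then 1 else 0 := by
  simp only [Term.le, Term.eval]
  split_ifs <;> omega

theorem Term.eval_eqv (a b : Term) : (a.eqv b).eval m env =
    if a.eval m env = b.eval m env then 1 else 0 := by
  simp only [Term.eqv, Term.eval_mul, Term.eval_le_term]
  split_ifs <;> omega

end

/-! ### Reading the answer of the oracle -/

section Decoding

variable {n : ℕ}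

/-- The code of a set preceded by its rank. -/
noncomputable def row (ρ : Set (Fin n) → ℕ) (X : Set (Fin n)) : List ℕ := ρ X :: charVec X

/-- The code of a list of sets, with a total rank function. -/
noncomputable def block (ρ : Set (Fin n) → ℕ) (l : List (Set (Fin n))) : List ℕ :=
  l.length :: l.flatMap (row ρ)

/-- The code of a positive answer of the oracle, with a total rank function. -/
noncomputable def codeWord (ρ : Set (Fin n) → ℕ) (r : ℕ) (lP lS lL : List (Set (Fin n))) :
    List ℕ :=
  n :: 1 :: 0 :: r :: (block ρ lP ++ block ρ lS ++ block ρ lL)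

/-- The lists contain, without repetition, the three classes of the locked structure of `M`. -/
def Lists (M : Matroid (Fin n)) (lP lS lL : List (Set (Fin n))) : Prop :=
  lP.Nodup ∧ lS.Nodup ∧ lL.Nodup ∧ (∀ X, X ∈ lP ↔ X ∈ parallelClosures M) ∧
    (∀ X, X ∈ lS ↔ X ∈ coparallelClosures M) ∧ ∀ X, X ∈ lL ↔ X ∈ lockedSets M

/-- Every set occurring in the code lies in the domain of the partial rank function, so its default
value 0 is never used and `rk` can replace it. -/
theorem codesAnswer_iff {c k : ℕ} {M : Matroid (Fin n)} (hE : M.E = Set.univ)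
    (hl : lockedNumber M ≤ c * n ^ k) {w : List ℕ} :
    CodesAnswer (lockedOracle c k M) w ↔ ∃ lP lS lL, Lists M lP lS lL ∧
      w = codeWord (rk M) (rk M Set.univ) lP lS lL := by
  have hρ : ∀ X, X ∈ parallelClosures M ∪ coparallelClosures M ∪ lockedSets M ∪ {∅, M.E} →
      ((lockedStructure M).ρ X).getD 0 = rk M X := by
    intro X hX
    simp only [lockedStructure]
    rw [if_pos hX]
    rfl
  have h0 : ((lockedStructure M).ρ ∅).getD 0 = 0 := by
    rw [hρ ∅ (by simp), rk_empty]
  have h1 : ((lockedStructure M).ρ Set.univ).getD 0 = rk M Set.univ :=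
    hρ _ (by simp [hE])
  have hblock : ∀ l : List (Set (Fin n)), (∀ X ∈ l, X ∈ parallelClosures M ∪
      coparallelClosures M ∪ lockedSets M ∪ {∅, M.E}) →
      encodeSets (lockedStructure M).ρ l = block (rk M) l := by
    intro l h
    rw [encodeSets, block]
    congr 1
    rw [List.flatMap_def, List.flatMap_def]
    congr 1
    refine List.map_congr_left fun X hX => ?_
    rw [hρ X (h X hX), row]
  rw [lockedOracle, if_pos hl]
  have hcode : ∀ lP lS lL, Lists M lP lS lL →
      ((lockedStructure M).ρ ∅).getD 0 :: ((lockedStructure M).ρ Set.univ).getD 0 ::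
        (encodeSets (lockedStructure M).ρ lP ++ encodeSets (lockedStructure M).ρ lS ++
          encodeSets (lockedStructure M).ρ lL) = 0 :: rk M Set.univ ::
        (block (rk M) lP ++ block (rk M) lS ++ block (rk M) lL) := by
    rintro lP lS lL ⟨-, -, -, hP, hS, hL⟩
    rw [h0, h1, hblock lP, hblock lS, hblock lL]
    · exact fun X hX => Or.inl (Or.inr ((hL X).mp hX))
    · exact fun X hX => Or.inl (Or.inl (Or.inr ((hS X).mp hX)))
    · exact fun X hX => Or.inl (Or.inl (Or.inl ((hP X).mp hX)))
  constructor
  · rintro ⟨v, ⟨lP, lS, lL, e1, e2, e3, e4, e5, e6, rfl⟩, rfl⟩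
    have h : Lists M lP lS lL := ⟨e1, e2, e3, e4, e5, e6⟩
    refine ⟨lP, lS, lL, h, ?_⟩
    rw [hcode lP lS lL h, codeWord]
  · rintro ⟨lP, lS, lL, h, rfl⟩
    refine ⟨_, ⟨lP, lS, lL, h.1, h.2.1, h.2.2.1, h.2.2.2.1, h.2.2.2.2.1, h.2.2.2.2.2, rfl⟩, ?_⟩
    rw [hcode lP lS lL h, codeWord]

theorem length_charVec (X : Set (Fin n)) : (charVec X).length = n := by simp [charVec]

theorem length_row (ρ : Set (Fin n) → ℕ) (X : Set (Fin n)) : (row ρ X).length = n + 1 := by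
  simp [row, length_charVec]

open Classical in
theorem getD_charVec (X : Set (Fin n)) (e : Fin n) :
    (charVec X).getD e 0 = if e ∈ X then 1 else 0 := by
  simp [charVec, List.getD_eq_getElem?_getD]

theorem length_flatMap_of_const {α β : Type*} {f : α → List β} {b : ℕ}
    (hf : ∀ x, (f x).length = b) (l : List α) : (l.flatMap f).length = l.length * b := by
  induction l with
  | nil => simp
  | cons x l ih => simp [ih, hf, Nat.succ_mul, add_comm]

theorem getD_append_add {β : Type*} (l l' : List β) (i : ℕ) (d : β) :
    (l ++ l').getD (l.length + i) d = l'.getD i d := by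
  rw [List.getD_append_right _ _ _ _ (Nat.le_add_right _ _), Nat.add_sub_cancel_left]

theorem getD_flatMap_of_const {α β : Type*} {f : α → List β} {b : ℕ}
    (hf : ∀ x, (f x).length = b) (l : List α) (d : β) (i j : ℕ) (hi : i < l.length) (hj : j < b) :
    (l.flatMap f).getD (i * b + j) d = (f l[i]).getD j d := by
  induction l generalizing i with
  | nil => simp at hi
  | cons x l ih =>
    rw [List.flatMap_cons]
    rcases i with _ | i
    · rw [List.getD_append _ _ _ _ (by rw [hf]; omega)]
      simp
    · rw [show (i + 1) * b + j = (f x).length + (i * b + j) by rw [hf]; ring, getD_append_add,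
        ih i (by simpa using hi)]
      simp

/-- The position of the code of the `q`-th listed set, the classes having `p`, `s` and an
arbitrary number of members. -/
def rowPos (n p s q : ℕ) : ℕ :=
  5 + q * (n + 1) + (if p ≤ q then 1 else 0) + (if p + s ≤ q then 1 else 0)

open Classical in
/-- The input `m` contains the code of the given lists. -/
structure Decodes (ρ : Set (Fin n) → ℕ) (r : ℕ) (lP lS lL : List (Set (Fin n))) (m : ℕ → ℕ) :
    Prop where
  size : m 0 = n
  rank : m 3 = r
  lenP : m 4 = lP.length
  lenS : m (5 + lP.length * (n + 1)) = lS.length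
  lenL : m (6 + (lP.length + lS.length) * (n + 1)) = lL.length
  rankRow : ∀ q (h : q < (lP ++ lS ++ lL).length),
    m (rowPos n lP.length lS.length q) = ρ (lP ++ lS ++ lL)[q]
  bitRow : ∀ q (h : q < (lP ++ lS ++ lL).length) (e : Fin n),
    m (rowPos n lP.length lS.length q + 1 + e) = if e ∈ (lP ++ lS ++ lL)[q] then 1 else 0

/-- Five header entries precede the first row, and every row has length `n + 1`. The length entries
of the second and third lists each shift all later rows by one. -/
theorem decodes_codeWord (ρ : Set (Fin n) → ℕ) (r : ℕ) (lP lS lL : List (Set (Fin n))) :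
    Decodes ρ r lP lS lL (inputFun (codeWord ρ r lP lS lL)) := by
  classical
  have hlen := fun l => length_flatMap_of_const (length_row ρ) l
  have hw : codeWord ρ r lP lS lL = [n, 1, 0, r, lP.length] ++ (lP.flatMap (row ρ) ++
      ([lS.length] ++ (lS.flatMap (row ρ) ++ ([lL.length] ++ lL.flatMap (row ρ))))) := by
    simp [codeWord, block]
  have hskip : ∀ i, inputFun (codeWord ρ r lP lS lL) (5 + i) = (lP.flatMap (row ρ) ++
      ([lS.length] ++ (lS.flatMap (row ρ) ++ ([lL.length] ++ lL.flatMap (row ρ))))).getD i 0 := by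
    intro i
    rw [inputFun, hw]
    exact getD_append_add [n, 1, 0, r, lP.length] _ i 0
  have hskipP : ∀ i, inputFun (codeWord ρ r lP lS lL) (5 + (lP.length * (n + 1) + i)) =
      ([lS.length] ++ (lS.flatMap (row ρ) ++ ([lL.length] ++ lL.flatMap (row ρ)))).getD i 0 := by
    intro i
    rw [hskip, ← hlen, getD_append_add]
  have hskipS : ∀ i, inputFun (codeWord ρ r lP lS lL)
      (5 + (lP.length * (n + 1) + (1 + (lS.length * (n + 1) + i)))) =
      ([lL.length] ++ lL.flatMap (row ρ)).getD i 0 := by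
    intro i
    rw [hskipP, ← hlen lS]
    exact (getD_append_add [lS.length] _ _ 0).trans (getD_append_add _ _ _ 0)
  have hrow : ∀ q (h : q < (lP ++ lS ++ lL).length) (j : ℕ), j < n + 1 →
      inputFun (codeWord ρ r lP lS lL) (rowPos n lP.length lS.length q + j) =
        (row ρ (lP ++ lS ++ lL)[q]).getD j 0 := by
    intro q h j hj
    unfold rowPos
    simp only [List.length_append] at h
    by_cases h1 : q < lP.length
    · rw [if_neg (by omega), if_neg (by omega), add_zero, add_zero, add_assoc, hskip,
        List.getD_append, getD_flatMap_of_const (length_row ρ) _ _ _ _ h1 hj,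
        List.getElem_append_left (by simp; omega), List.getElem_append_left h1]
      rw [hlen]
      calc q * (n + 1) + j < (q + 1) * (n + 1) := by rw [Nat.succ_mul]; omega
        _ ≤ _ := Nat.mul_le_mul_right _ h1
    · obtain ⟨q, rfl⟩ := Nat.exists_eq_add_of_le (not_lt.mp h1)
      by_cases h2 : q < lS.length
      · rw [if_pos (by omega), if_neg (by omega), show 5 + (lP.length + q) * (n + 1) + 1 + 0 + j =
          5 + (lP.length * (n + 1) + (1 + (q * (n + 1) + j))) by ring, hskipP]
        refine (getD_append_add [lS.length] _ _ 0).trans ?_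
        rw [List.getD_append, getD_flatMap_of_const (length_row ρ) _ _ _ _ h2 hj,
          List.getElem_append_left (by simp; omega), List.getElem_append_right (by omega)]
        · simp
        rw [hlen]
        calc q * (n + 1) + j < (q + 1) * (n + 1) := by rw [Nat.succ_mul]; omega
          _ ≤ _ := Nat.mul_le_mul_right _ h2
      · obtain ⟨q, rfl⟩ := Nat.exists_eq_add_of_le (not_lt.mp h2)
        rw [if_pos (by omega), if_pos (by omega),
          show 5 + (lP.length + (lS.length + q)) * (n + 1) + 1 + 1 + j =
          5 + (lP.length * (n + 1) + (1 + (lS.length * (n + 1) + (1 + (q * (n + 1) + j))))) by ring,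
          hskipS]
        refine (getD_append_add [lL.length] _ _ 0).trans ?_
        rw [getD_flatMap_of_const (length_row ρ) _ _ _ _ (by omega) hj,
          List.getElem_append_right (by simp)]
        simp [← add_assoc]
  refine ⟨rfl, rfl, rfl, ?_, ?_, ?_, ?_⟩
  · exact hskipP 0
  · rw [show 6 + (lP.length + lS.length) * (n + 1) =
      5 + (lP.length * (n + 1) + (1 + (lS.length * (n + 1) + 0))) by ring, hskipS]
    rfl
  · intro q h
    exact hrow q h 0 (by omega)
  · intro q h e
    rw [add_assoc, hrow q h (1 + e) (by omega), row, add_comm 1, List.getD_cons_succ, getD_charVec]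

/-- There are at most `n` parallel and `n` coparallel closures, since each is the closure of an
element. The oracle bound controls the number of locked sets; all other entries are at most `n + 1`.
-/
theorem le_of_mem_codeWord {c k : ℕ} {M : Matroid (Fin n)} (hE : M.E = Set.univ)
    (hl : lockedNumber M ≤ c * n ^ k) {lP lS lL : List (Set (Fin n))} (h : Lists M lP lS lL)
    {a : ℕ} (ha : a ∈ codeWord (rk M) (rk M Set.univ) lP lS lL) : a ≤ n + 1 + c * n ^ k := by
  classical
  have hr := rk_le M
  have hlen : ∀ (l : List (Set (Fin n))) (A : Set (Set (Fin n))), l.Nodup → (∀ X, X ∈ l ↔ X ∈ A) →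
      l.length = A.ncard := by
    intro l A hn hA
    have : A = (l.toFinset : Set (Set (Fin n))) := by ext X; simp [hA]
    rw [this, Set.ncard_coe_finset, List.toFinset_card_of_nodup hn]
  have hpar : ∀ M : Matroid (Fin n), M.E = Set.univ → (parallelClosures M).ncard ≤ n := by
    intro M hE
    have : parallelClosures M = parallelClosure M '' Set.univ := by
      ext X
      simp [parallelClosures, hE, eq_comm]
    rw [this]
    refine (Set.ncard_image_le (Set.toFinite _)).trans ?_
    simp [Set.ncard_univ]
  obtain ⟨nP, nS, nL, hP, hS, hL⟩ := h
  have lP' := (hlen lP _ nP hP).trans_le (hpar M hE)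
  have lS' := (hlen lS _ nS hS).trans_le (hpar M.dual hE)
  have lL' : lL.length ≤ c * n ^ k := (hlen lL _ nL hL).trans_le hl
  have hrow : ∀ l : List (Set (Fin n)), a ∈ l.flatMap (row (rk M)) → a ≤ n + 1 := by
    intro l ha
    obtain ⟨X, -, hX⟩ := List.mem_flatMap.mp ha
    rcases List.mem_cons.mp hX with rfl | hX
    · exact (hr X).trans (Nat.le_succ n)
    · obtain ⟨i, -, rfl⟩ := List.mem_map.mp hX
      split_ifs <;> omega
  simp only [codeWord, block, List.mem_cons, List.mem_append] at ha
  have := hr Set.univ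
  rcases ha with h | h | h | h | ((h | h) | (h | h)) | (h | h)
  · omega
  · omega
  · omega
  · omega
  · omega
  · have := hrow _ h; omega
  · omega
  · have := hrow _ h; omega
  · omega
  · have := hrow _ h; omega

end Decoding

/-! ### Terms reading the answer of the oracle -/

/-- The size of the ground set. -/
def sizeTerm : Term := .inp (.const 0)

/-- The rank of the matroid. -/
def rankTerm : Term := .inp (.const 3)

/-- The number of parallel closures. -/
def lenPTerm : Term := .inp (.const 4)

/-- The number of coparallel closures. -/
def lenSTerm : Term := .inp (.add (.const 5) (.mul lenPTerm (.add sizeTerm (.const 1))))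

/-- The number of locked sets. -/
def lenLTerm : Term :=
  .inp (.add (.const 6) (.mul (.add lenPTerm lenSTerm) (.add sizeTerm (.const 1))))

/-- The position of the code of the `q`-th listed set. -/
def posTerm (q : Term) : Term :=
  .add (.add (.add (.const 5) (.mul q (.add sizeTerm (.const 1)))) (.le lenPTerm q))
    (.le (.add lenPTerm lenSTerm) q)

/-- The rank of the `q`-th listed set. -/
def setRankTerm (q : Term) : Term := .inp (posTerm q)

/-- The truth value of the membership of `e` in the `q`-th listed set. -/
def bitTerm (q e : Term) : Term := .inp (.add (.add (posTerm q) (.const 1)) e)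

/-- The cardinality of the `q`-th listed set. -/
def cardTerm (q : Term) : Term := .sum q.fresh sizeTerm (bitTerm q (.var q.fresh))

section

variable {n r : ℕ} {ρ : Set (Fin n) → ℕ} {lP lS lL : List (Set (Fin n))} {m : ℕ → ℕ}
  (hD : Decodes ρ r lP lS lL m) (env : ℕ → ℕ)

include hD

theorem eval_sizeTerm : sizeTerm.eval m env = n := hD.size

theorem eval_rankTerm : rankTerm.eval m env = r := hD.rank

theorem eval_lenPTerm : lenPTerm.eval m env = lP.length := hD.lenP

theorem eval_lenSTerm : lenSTerm.eval m env = lS.length := by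
  rw [lenSTerm, Term.eval, Term.eval, Term.eval_mul, Term.eval, Term.eval, Term.eval,
    eval_sizeTerm hD, eval_lenPTerm hD, hD.lenS]

theorem eval_lenLTerm : lenLTerm.eval m env = lL.length := by
  rw [lenLTerm, Term.eval, Term.eval, Term.eval_mul, Term.eval, Term.eval, Term.eval, Term.eval,
    eval_sizeTerm hD, eval_lenPTerm hD, eval_lenSTerm hD, hD.lenL]

variable {env}

theorem eval_posTerm {tq : Term} {q : ℕ} (hq : tq.eval m env = q) :
    (posTerm tq).eval m env = rowPos n lP.length lS.length q := by
  simp only [posTerm, Term.eval, Term.eval_mul, Term.eval_le_term, hq, eval_sizeTerm hD,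
    eval_lenPTerm hD, eval_lenSTerm hD, rowPos]

theorem eval_setRankTerm {tq : Term} {q : ℕ} (hq : tq.eval m env = q)
    (h : q < (lP ++ lS ++ lL).length) :
    (setRankTerm tq).eval m env = ρ (lP ++ lS ++ lL)[q] := by
  rw [setRankTerm, Term.eval, eval_posTerm hD hq, hD.rankRow q h]

open Classical in
theorem eval_bitTerm {tq te : Term} {q : ℕ} {e : Fin n} (hq : tq.eval m env = q)
    (he : te.eval m env = e) (h : q < (lP ++ lS ++ lL).length) :
    (bitTerm tq te).eval m env = if e ∈ (lP ++ lS ++ lL)[q] then 1 else 0 := by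
  rw [bitTerm, Term.eval, Term.eval, Term.eval, eval_posTerm hD hq, he]
  exact hD.bitRow q h e

theorem eval_cardTerm {tq : Term} {q : ℕ} (hq : tq.eval m env = q)
    (h : q < (lP ++ lS ++ lL).length) :
    (cardTerm tq).eval m env = ((lP ++ lS ++ lL)[q]).ncard := by
  classical
  rw [cardTerm, Term.eval, eval_sizeTerm hD, Finset.sum_range]
  have : ∀ e : Fin n, (bitTerm tq (.var tq.fresh)).eval m (Function.update env tq.fresh e) =
      if e ∈ (lP ++ lS ++ lL)[q] then 1 else 0 := fun e =>
    eval_bitTerm hD ((tq.eval_update env le_rfl e).trans hq) (by simp [Term.eval]) h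
  rw [Finset.sum_congr rfl fun e _ => this e]
  generalize (lP ++ lS ++ lL)[q] = X
  rw [Finset.sum_boole, Nat.cast_id, ← Set.ncard_coe_finset]
  congr 1
  ext e
  simp

end

theorem flatMap_eq_flatMap_range {α β : Type*} {f : α → List β} {g : ℕ → List β} (l : List α)
    (h : ∀ i (hi : i < l.length), g i = f l[i]) :
    (List.range l.length).flatMap g = l.flatMap f := by
  induction l generalizing g with
  | nil => simp
  | cons x l ih =>
    rw [List.length_cons, List.range_succ_eq_map, List.flatMap_cons, List.flatMap_cons,
      List.flatMap_map, h 0 (by simp), ih fun i hi => h (i + 1) (by simpa using hi)]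
    simp

theorem flatMap_range_eq_map_finRange {n : ℕ} {β : Type*} {f : Fin n → β} {g : ℕ → List β}
    (h : ∀ i : Fin n, g i = [f i]) :
    (List.range n).flatMap g = (List.finRange n).map f := by
  have h1 := flatMap_eq_flatMap_range (f := fun i => [f i]) (g := g) (List.finRange n)
    (fun i hi => by
      have := h ⟨i, by simpa using hi⟩
      simpa using this)
  rw [List.length_finRange] at h1
  rw [h1]
  exact List.flatMap_pure_eq_map f _

theorem flatMap_range_mul {β : Type*} (f : ℕ → List β) (a b : ℕ) :
    (List.range (a * b)).flatMap f =
      (List.range a).flatMap fun i => (List.range b).flatMap fun j => f (i * b + j) := by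
  induction a with
  | zero => simp
  | succ a ih =>
    rw [Nat.succ_mul, List.range_add, List.flatMap_append, ih, List.range_succ,
      List.flatMap_append, List.flatMap_map]
    simp

theorem flatMap_range_congr {β : Type*} {f g : ℕ → List β} {a : ℕ} (h : ∀ i < a, f i = g i) :
    (List.range a).flatMap f = (List.range a).flatMap g := by
  rw [List.flatMap_def, List.flatMap_def]
  congr 1
  exact List.map_congr_left fun i hi => h i (List.mem_range.mp hi)

/-! ### The dual locked structure -/

/-- Writes the code of a list of sets. The number of sets is given by `len`; the index of the set
is variable `0` and the index of the element is variable `1`. -/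
def setsWriter (len rank bit : Term) : Writer :=
  .seq (.emit len) (.iter 0 len (.seq (.emit rank) (.iter 1 sizeTerm (.emit bit))))

open Classical in
theorem word_setsWriter {n : ℕ} {m : ℕ → ℕ} {env : ℕ → ℕ} (hn : ∀ env, sizeTerm.eval m env = n)
    {len rank bit : Term} {l : List (Set (Fin n))} {ρ : Set (Fin n) → ℕ}
    (hlen : len.eval m env = l.length)
    (hrank : ∀ i (hi : i < l.length), rank.eval m (Function.update env 0 i) = ρ l[i])
    (hbit : ∀ i (hi : i < l.length) (e : Fin n),
      bit.eval m (Function.update (Function.update env 0 i) 1 e) = if e ∈ l[i] then 1 else 0) :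
    (setsWriter len rank bit).word m env = block ρ l := by
  simp only [setsWriter, Writer.word, hlen, hn, block, List.singleton_append]
  congr 1
  refine flatMap_eq_flatMap_range l fun i hi => ?_
  rw [hrank i hi, row, charVec]
  congr 1
  exact flatMap_range_eq_map_finRange fun e => by rw [hbit i hi e]

/-- The dual rank of the parallel closure with index `q`. -/
def dualRankPTerm (q : Term) : Term :=
  .cond (.eqv (cardTerm q) sizeTerm) (.sub sizeTerm rankTerm) (cardTerm q)

/-- The dual rank of the coparallel closure with index `q`. -/
def dualRankSTerm (q : Term) : Term :=
  .cond (.eqv (cardTerm q) sizeTerm) (.sub sizeTerm rankTerm) (.const 1)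

/-- The dual rank of the complement of the locked set with index `q`. -/
def dualRankLTerm (q : Term) : Term :=
  .sub (.add (setRankTerm q) (.sub sizeTerm (cardTerm q))) rankTerm

/-- Writes the answer of the oracle for the dual matroid. -/
def dualWriter : Writer :=
  .seq (.emit sizeTerm) (.seq (.emit (.const 1)) (.seq (.emit (.const 0))
    (.seq (.emit (.sub sizeTerm rankTerm))
      (.seq (.seq
        (setsWriter lenSTerm (dualRankSTerm (.add lenPTerm (.var 0)))
          (bitTerm (.add lenPTerm (.var 0)) (.var 1)))
        (setsWriter lenPTerm (dualRankPTerm (.var 0)) (bitTerm (.var 0) (.var 1))))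
        (setsWriter lenLTerm (dualRankLTerm (.add (.add lenPTerm lenSTerm) (.var 0)))
          (.sub (.const 1) (bitTerm (.add (.add lenPTerm lenSTerm) (.var 0)) (.var 1))))))))

section

variable {n : ℕ} {M : Matroid (Fin n)} {lP lS lL : List (Set (Fin n))} {m : ℕ → ℕ} {env : ℕ → ℕ}

theorem eval_dualRankLTerm (hE : M.E = Set.univ)
    (hD : Decodes (rk M) (rk M Set.univ) lP lS lL m) {tq : Term} {q : ℕ}
    (hq : tq.eval m env = q) (h : q < (lP ++ lS ++ lL).length) :
    (dualRankLTerm tq).eval m env = rk M.dual (((lP ++ lS ++ lL)[q])ᶜ) := by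
  rw [dualRankLTerm, Term.eval, Term.eval, Term.eval, eval_setRankTerm hD hq h,
    eval_cardTerm hD hq h, eval_sizeTerm hD, eval_rankTerm hD, rk_dual_compl hE]

theorem Lists.dual (hE : M.E = Set.univ) (h : Lists M lP lS lL) :
    Lists M.dual lS lP (lL.map compl) := by
  obtain ⟨h1, h2, h3, h4, h5, h6⟩ := h
  refine ⟨h2, h1, h3.map compl_injective, h5, ?_, ?_⟩
  · rw [coparallelClosures_dual]; exact h4
  · intro X
    rw [mem_lockedSets_dual hE, ← h6, List.mem_map]
    exact ⟨by rintro ⟨Y, hY, rfl⟩; rwa [compl_compl], fun h => ⟨_, h, compl_compl X⟩⟩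

/-- The first two lists are exchanged, the bits of locked sets are flipped, and the ranks come from
the formulas for the dual structure. -/
theorem word_dualWriter (hE : M.E = Set.univ) (hM : TwoConnected M) (hl : Lists M lP lS lL)
    (hD : Decodes (rk M) (rk M Set.univ) lP lS lL m) :
    dualWriter.word m env = codeWord (rk M.dual) (rk M.dual Set.univ) lS lP (lL.map compl) := by
  classical
  have hn := eval_sizeTerm hD
  have hgetP : ∀ i (hi : i < lP.length), (lP ++ lS ++ lL)[i]'(by simp; omega) = lP[i] := by
    intro i hi
    rw [List.getElem_append_left (by simp; omega), List.getElem_append_left hi]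
  have hgetS : ∀ i (hi : i < lS.length),
      (lP ++ lS ++ lL)[lP.length + i]'(by simp; omega) = lS[i] := by
    intro i hi
    rw [List.getElem_append_left (by simp; omega), List.getElem_append_right (by omega)]
    simp
  have hgetL : ∀ i (hi : i < lL.length),
      (lP ++ lS ++ lL)[lP.length + lS.length + i]'(by simp; omega) = lL[i] := by
    intro i hi
    rw [List.getElem_append_right (by simp)]
    simp
  have hS : (setsWriter lenSTerm (dualRankSTerm (.add lenPTerm (.var 0)))
      (bitTerm (.add lenPTerm (.var 0)) (.var 1))).word m env = block (rk M.dual) lS := by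
    refine word_setsWriter hn (eval_lenSTerm hD env) (fun i hi => ?_) (fun i hi e => ?_)
    · have hq : (Term.add lenPTerm (.var 0)).eval m (Function.update env 0 i) = lP.length + i := by
        rw [Term.eval, eval_lenPTerm hD, Term.eval, Function.update_self]
      rw [dualRankSTerm, Term.eval_cond, Term.eval_eqv, Term.eval, Term.eval,
        eval_cardTerm hD hq (by simp; omega), hgetS i hi, hn, eval_rankTerm hD,
        rk_dual_of_mem_coparallelClosures hE hM ((hl.2.2.2.2.1 _).mp (List.getElem_mem hi))]
      split_ifs <;> simp_all
    · rw [← hgetS i hi]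
      refine eval_bitTerm hD ?_ (by simp [Term.eval]) _
      rw [Term.eval, eval_lenPTerm hD, Term.eval, Function.update_of_ne (by omega),
        Function.update_self]
  have hP : (setsWriter lenPTerm (dualRankPTerm (.var 0)) (bitTerm (.var 0) (.var 1))).word m env =
      block (rk M.dual) lP := by
    refine word_setsWriter hn (eval_lenPTerm hD env) (fun i hi => ?_) (fun i hi e => ?_)
    · have hq : (Term.var 0).eval m (Function.update env 0 i) = i := by
        rw [Term.eval, Function.update_self]
      rw [dualRankPTerm, Term.eval_cond, Term.eval_eqv, Term.eval,
        eval_cardTerm hD hq (by simp; omega), hgetP i hi, hn, eval_rankTerm hD,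
        rk_dual_of_mem_parallelClosures hE hM ((hl.2.2.2.1 _).mp (List.getElem_mem hi))]
      split_ifs <;> simp_all
    · rw [← hgetP i hi]
      refine eval_bitTerm hD ?_ (by simp [Term.eval]) _
      rw [Term.eval, Function.update_of_ne (by omega), Function.update_self]
  have hL : (setsWriter lenLTerm (dualRankLTerm (.add (.add lenPTerm lenSTerm) (.var 0)))
      (.sub (.const 1) (bitTerm (.add (.add lenPTerm lenSTerm) (.var 0)) (.var 1)))).word m env =
      block (rk M.dual) (lL.map compl) := by
    refine word_setsWriter hn ((eval_lenLTerm hD env).trans (by simp)) (fun i hi => ?_)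
      (fun i hi e => ?_)
    · rw [List.length_map] at hi
      rw [List.getElem_map, ← hgetL i hi]
      refine eval_dualRankLTerm hE hD ?_ _
      simp only [Term.eval, eval_lenPTerm hD, eval_lenSTerm hD, Function.update_self]
    · rw [List.length_map] at hi
      have hq : (Term.add (Term.add lenPTerm lenSTerm) (.var 0)).eval m
          (Function.update (Function.update env 0 i) 1 e) = lP.length + lS.length + i := by
        simp only [Term.eval, eval_lenPTerm hD, eval_lenSTerm hD]
        rw [Function.update_of_ne (by omega), Function.update_self]
      rw [Term.eval, eval_bitTerm hD (e := e) hq (by simp [Term.eval]) (by simp; omega),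
        hgetL i hi, List.getElem_map, Term.eval]
      by_cases h : e ∈ lL[i] <;> simp [h]
  simp only [dualWriter, Writer.word, hS, hP, hL, hn, eval_rankTerm hD, Term.eval,
    List.singleton_append, codeWord, rk_dual_univ hE]

end

/-! ### The pair of graphs -/

/-- The truth value of the adjacency of two vertices of the incidence graph, the elements being
numbered before the sets. -/
def incAdjTerm (bit : Term → Term → Term) (v v' : Term) : Term :=
  .add (.mul (.mul (.le (.add v (.const 1)) sizeTerm) (.le sizeTerm v'))
      (bit (.sub v' sizeTerm) v))
    (.mul (.mul (.le (.add v' (.const 1)) sizeTerm) (.le sizeTerm v))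
      (bit (.sub v sizeTerm) v'))

/-- The weight of a vertex of the incidence graph. -/
def incWeightTerm (weight : Term → Term) (rank v : Term) : Term :=
  .cond (.le sizeTerm v) (weight (.sub v sizeTerm)) (.add (.const 2) rank)

/-- The truth value of the adjacency of two vertices of the pendant graph. -/
def pendantAdjTerm (adj : Term → Term → Term) (weight : Term → Term) (v j v' j' : Term) : Term :=
  .add (.mul (.mul (.eqv j (.const 0)) (.eqv j' (.const 0))) (adj v v'))
    (.mul (.eqv v v') (.add
      (.mul (.eqv j (.const 0)) (.mul (.le (.const 1) j') (.le j' (weight v))))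
      (.mul (.eqv j' (.const 0)) (.mul (.le (.const 1) j) (.le j (weight v))))))

/-- Writes a graph whose vertices are indexed by pairs. -/
def pairGraphWriter (a b adj : Term) : Writer :=
  .seq (.emit (.mul a b)) (.iter 0 a (.iter 1 b (.iter 2 a (.iter 3 b (.emit adj)))))

open Classical in
theorem encodeGraph_eq {a : ℕ} (G : SimpleGraph (Fin a)) (g : ℕ → ℕ → ℕ)
    (hg : ∀ x y : Fin a, g x y = if G.Adj x y then 1 else 0) :
    encodeGraph G =
      a :: (List.range a).flatMap fun x => (List.range a).flatMap fun y => [g x y] := by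
  have h : ∀ x : Fin a, (List.range a).flatMap (fun y => [g x y]) =
      (List.finRange a).map fun y => if G.Adj x y then 1 else 0 := fun x =>
    flatMap_range_eq_map_finRange fun y => by rw [hg]
  have h' := flatMap_eq_flatMap_range (List.finRange a)
    (f := fun x => (List.finRange a).map fun y => if G.Adj x y then 1 else 0)
    (g := fun x => (List.range a).flatMap fun y => [g x y])
    (fun i hi => by rw [← h]; simp)
  rw [List.length_finRange] at h'
  rw [encodeGraph, h']

-- A vertex number `x` stands for the pair `(x / b, x % b)`, so four nested iterations traverse the
-- adjacency matrix row by row.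
open Classical in
theorem word_pairGraphWriter {V : Type*} {a b : ℕ} {m env : ℕ → ℕ} {ta tb adj : Term}
    (ha : ∀ env, ta.eval m env = a) (hb : ∀ env, tb.eval m env = b) (f : Fin a ≃ V)
    (G : SimpleGraph (V × Fin b))
    (hadj : ∀ (i : Fin a) (j : Fin b) (i' : Fin a) (j' : Fin b) (env : ℕ → ℕ), env 0 = i →
      env 1 = j → env 2 = i' → env 3 = j' →
      adj.eval m env = if G.Adj (f i, j) (f i', j') then 1 else 0) :
    (pairGraphWriter ta tb adj).word m env =
      encodeGraph (G.comap (finProdFinEquiv.symm.trans (f.prodCongr (Equiv.refl (Fin b))))) := by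
  let g : ℕ → ℕ → ℕ := fun x y => adj.eval m (Function.update (Function.update (Function.update
    (Function.update env 0 (x / b)) 1 (x % b)) 2 (y / b)) 3 (y % b))
  have hg : ∀ x y : Fin (a * b), g x y = if (G.comap (finProdFinEquiv.symm.trans
      (f.prodCongr (Equiv.refl (Fin b))))).Adj x y then 1 else 0 := by
    intro x y
    refine (hadj x.divNat x.modNat y.divNat y.modNat _ (by simp) (by simp) (by simp)
      (by simp)).trans ?_
    congr 1
  rw [encodeGraph_eq _ g hg, flatMap_range_mul]
  simp only [pairGraphWriter, Writer.word, Term.eval_mul, ha, hb, List.singleton_append]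
  congr 1
  refine flatMap_range_congr fun i _ => flatMap_range_congr fun j hj => ?_
  rw [flatMap_range_mul]
  refine flatMap_range_congr fun i' _ => flatMap_range_congr fun j' hj' => ?_
  have hb : 0 < b := by omega
  simp only [g]
  rw [Nat.add_comm (i * b), Nat.add_comm (i' * b), Nat.add_mul_div_right _ _ hb,
    Nat.add_mul_div_right _ _ hb, Nat.add_mul_mod_self_right, Nat.add_mul_mod_self_right,
    Nat.div_eq_of_lt hj, Nat.div_eq_of_lt hj', Nat.mod_eq_of_lt hj, Nat.mod_eq_of_lt hj',
    zero_add, zero_add]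

/-- Writes the incidence graph of a locked structure with pendant vertices; the listed sets are
given by their number, their characteristic functions and their weights. -/
def incGraphWriter (num : Term) (bit : Term → Term → Term) (weight : Term → Term) (rank : Term) :
    Writer :=
  pairGraphWriter (.add sizeTerm num) (.add (.mul (.const 2) sizeTerm) (.const 6))
    (pendantAdjTerm (incAdjTerm bit) (incWeightTerm weight rank) (.var 0) (.var 1) (.var 2)
      (.var 3))

section

variable {n Q : ℕ} {N : Matroid (Fin n)} {m : ℕ → ℕ}

/-- The numbering of the vertices of the incidence graph given by a numbering of the sets. -/
def vertexEquiv (κ : Fin Q ≃ Listed N) : Fin (n + Q) ≃ Fin n ⊕ Listed N :=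
  finSumFinEquiv.symm.trans (Equiv.sumCongr (Equiv.refl _) κ)

/-- The numbering of the vertices of the pendant graph given by a numbering of the sets. -/
def pendantEquiv (κ : Fin Q ≃ Listed N) :
    Fin ((n + Q) * (2 * n + 5 + 1)) ≃ (Fin n ⊕ Listed N) × Fin (2 * n + 5 + 1) :=
  finProdFinEquiv.symm.trans ((vertexEquiv κ).prodCongr (Equiv.refl _))

/-- The incidence graph of the locked structure of `N`, with pendant vertices. -/
noncomputable def structureGraph (N : Matroid (Fin n)) :
    SimpleGraph ((Fin n ⊕ Listed N) × Fin (2 * n + 5 + 1)) :=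
  pendantGraph (incGraph N) (incWeight N) (2 * n + 5)

-- `bit` and `weight` need be correct only on valid indices: elsewhere their values are multiplied
-- by 0.
open Classical in
theorem word_incGraphWriter (κ : Fin Q ≃ Listed N) {num rank : Term} {bit : Term → Term → Term}
    {weight : Term → Term} (hn : ∀ env, sizeTerm.eval m env = n)
    (hnum : ∀ env, num.eval m env = Q) (hrank : ∀ env, rank.eval m env = rk N Set.univ)
    (hbit : ∀ (env : ℕ → ℕ) (tq te : Term) (q : Fin Q) (e : Fin n), tq.eval m env = q →
      te.eval m env = e → (bit tq te).eval m env = if e ∈ (κ q).set then 1 else 0)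
    (hweight : ∀ (env : ℕ → ℕ) (tq : Term) (q : Fin Q), tq.eval m env = q →
      (weight tq).eval m env = (κ q).weight) (env : ℕ → ℕ) :
    (incGraphWriter num bit weight rank).word m env =
      encodeGraph ((structureGraph N).comap (pendantEquiv κ)) := by
  have hw : ∀ (env : ℕ → ℕ) (tv : Term) (v : Fin (n + Q)), tv.eval m env = v →
      (incWeightTerm weight rank tv).eval m env = incWeight N (vertexEquiv κ v) := by
    intro env tv v hv
    rw [incWeightTerm, Term.eval_cond, Term.eval_le_term, hn, Term.eval, hrank]
    induction v using Fin.addCases with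
    | left e =>
      replace hv : tv.eval m env = e := hv
      have h : ¬ n ≤ (e : ℕ) := by omega
      simp [hv, h, vertexEquiv, incWeight, Term.eval]
    | right q =>
      replace hv : tv.eval m env = n + q := hv
      rw [hweight env _ q (by rw [Term.eval, hv, hn]; omega)]
      simp [hv, vertexEquiv, incWeight]
  have ha : ∀ (env : ℕ → ℕ) (tv tv' : Term) (v v' : Fin (n + Q)), tv.eval m env = v →
      tv'.eval m env = v' → (incAdjTerm bit tv tv').eval m env =
        if (incGraph N).Adj (vertexEquiv κ v) (vertexEquiv κ v') then 1 else 0 := by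
    intro env tv tv' v v' hv hv'
    simp only [incAdjTerm, Term.eval, Term.eval_mul, Term.eval_le_term, hn]
    induction v using Fin.addCases with
    | left e =>
      replace hv : tv.eval m env = e := hv
      have h : ¬ n ≤ (e : ℕ) := by omega
      induction v' using Fin.addCases with
      | left e' =>
        replace hv' : tv'.eval m env = e' := hv'
        have h' : ¬ n ≤ (e' : ℕ) := by omega
        simp [hv, hv', h, h', vertexEquiv, incGraph, incAdj]
      | right q' =>
        replace hv' : tv'.eval m env = n + q' := hv'
        have h' : (e : ℕ) + 1 ≤ n := by omega
        rw [hbit env (tv'.sub sizeTerm) tv q' e (by rw [Term.eval, hv', hn]; omega) hv]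
        simp [hv, hv', h, h', vertexEquiv, incGraph, incAdj]
    | right q =>
      replace hv : tv.eval m env = n + q := hv
      have h : ¬ n + (q : ℕ) + 1 ≤ n := by omega
      induction v' using Fin.addCases with
      | left e' =>
        replace hv' : tv'.eval m env = e' := hv'
        have h' : ¬ n ≤ (e' : ℕ) := by omega
        have h'' : (e' : ℕ) + 1 ≤ n := by omega
        rw [hbit env (tv.sub sizeTerm) tv' q e' (by rw [Term.eval, hv, hn]; omega) hv']
        simp [hv, hv', h', h'', vertexEquiv, incGraph, incAdj]
      | right q' =>
        replace hv' : tv'.eval m env = n + q' := hv'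
        have h' : ¬ n + (q' : ℕ) + 1 ≤ n := by omega
        simp [hv, hv', h, h', vertexEquiv, incGraph, incAdj]
  refine word_pairGraphWriter (fun env => ?_) (fun env => ?_) (vertexEquiv κ) (structureGraph N) ?_
  · rw [Term.eval, hn, hnum]
  · rw [Term.eval, Term.eval_mul, hn]
    rfl
  · intro i j i' j' env h0 h1 h2 h3
    simp only [pendantAdjTerm, Term.eval, Term.eval_mul, Term.eval_le_term, Term.eval_eqv, h1, h3,
      ha env (.var 0) (.var 2) i i' h0 h2, hw env (.var 0) i h0, h0, h2]
    have hi : (i : ℕ) = i' ↔ vertexEquiv κ i = vertexEquiv κ i' := by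
      rw [(vertexEquiv κ).injective.eq_iff, Fin.ext_iff]
    simp only [structureGraph, pendantGraph, hi]
    have hirr : vertexEquiv κ i = vertexEquiv κ i' →
        ¬ (incGraph N).Adj (vertexEquiv κ i) (vertexEquiv κ i') := fun h h' =>
      (incGraph N).loopless.irrefl _ (h ▸ h')
    -- The three products in the adjacency term exclude one another, so their sum is 0 or 1.
    by_cases c1 : (j : ℕ) = 0 <;> by_cases c2 : (j' : ℕ) = 0 <;>
      by_cases c3 : vertexEquiv κ i = vertexEquiv κ i' <;>
      by_cases c4 : (j : ℕ) ≤ incWeight N (vertexEquiv κ i) <;>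
      by_cases c5 : (j' : ℕ) ≤ incWeight N (vertexEquiv κ i) <;>
      simp_all [Nat.one_le_iff_ne_zero]

end

/-! ### Numberings of the listed sets -/

section

variable {n : ℕ} {M : Matroid (Fin n)} {lP lS lL : List (Set (Fin n))} {m : ℕ → ℕ}

/-- A class of sets is numbered by a list of its members. -/
noncomputable def classEquiv {β : Type*} {l : List β} {A : Set β} (hn : l.Nodup)
    (h : ∀ X, X ∈ l ↔ X ∈ A) : Fin l.length ≃ A := by
  classical
  exact (hn.getEquiv l).trans (Equiv.subtypeEquivRight h)

theorem coe_classEquiv {β : Type*} {l : List β} {A : Set β} (hn : l.Nodup)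
    (h : ∀ X, X ∈ l ↔ X ∈ A) (i : Fin l.length) : (classEquiv hn h i : β) = l[i] := by
  simp [classEquiv]

/-- Complementation maps the locked sets of `M` to those of its dual. -/
def complEquiv (hE : M.E = Set.univ) : lockedSets M ≃ lockedSets M.dual :=
  (compl_involutive.toPerm compl).subtypeEquiv fun L => by
    change _ ↔ Lᶜ ∈ _
    rw [mem_lockedSets_dual hE, compl_compl]

/-- The listed sets of `M` are numbered by the lists. -/
noncomputable def listedEquiv (h : Lists M lP lS lL) :
    Fin (lP.length + (lS.length + lL.length)) ≃ Listed M :=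
  finSumFinEquiv.symm.trans (Equiv.sumCongr (classEquiv h.1 h.2.2.2.1)
    (finSumFinEquiv.symm.trans (Equiv.sumCongr (classEquiv h.2.1 h.2.2.2.2.1)
      (classEquiv h.2.2.1 h.2.2.2.2.2))))

/-- The listed sets of the dual of `M` are numbered by the lists for `M`. -/
noncomputable def listedDualEquiv (hE : M.E = Set.univ) (h : Lists M lP lS lL) :
    Fin (lP.length + (lS.length + lL.length)) ≃ Listed M.dual :=
  (finSumFinEquiv.symm.trans (Equiv.sumCongr
    (classEquiv (A := coparallelClosures M.dual) h.1
      (by rw [coparallelClosures_dual]; exact h.2.2.2.1))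
    (finSumFinEquiv.symm.trans (Equiv.sumCongr
      (classEquiv (A := parallelClosures M.dual) h.2.1 h.2.2.2.2.1)
      ((classEquiv h.2.2.1 h.2.2.2.2.2).trans (complEquiv hE)))))).trans
    (((Equiv.sumAssoc _ _ _).symm.trans
      (Equiv.sumCongr (Equiv.sumComm _ _) (Equiv.refl _))).trans (Equiv.sumAssoc _ _ _))

theorem getElem_append_three {β : Type*} (l₁ l₂ l₃ : List β)
    (q : Fin (l₁.length + (l₂.length + l₃.length))) :
    (q : ℕ) < (l₁ ++ l₂ ++ l₃).length := by
  have := q.2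
  simp only [List.length_append]
  omega

/-- The three kinds of listed sets, by their number. -/
theorem listed_cases (h : Lists M lP lS lL) (hE : M.E = Set.univ)
    (q : Fin (lP.length + (lS.length + lL.length)))
    (X : Set (Fin n)) (hX : X = (lP ++ lS ++ lL)[(q : ℕ)]'(getElem_append_three lP lS lL q)) :
    ((q : ℕ) < lP.length ∧
      (∃ P, listedEquiv h q = .inl P ∧ P.1 = X) ∧
      ∃ P, listedDualEquiv hE h q = .inr (.inl P) ∧ P.1 = X) ∨
    (lP.length ≤ q ∧ (q : ℕ) < lP.length + lS.length ∧
      (∃ S, listedEquiv h q = .inr (.inl S) ∧ S.1 = X) ∧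
      ∃ S, listedDualEquiv hE h q = .inl S ∧ S.1 = X) ∨
    (lP.length + lS.length ≤ q ∧
      (∃ L, listedEquiv h q = .inr (.inr L) ∧ L.1 = X) ∧
      ∃ L, listedDualEquiv hE h q = .inr (.inr L) ∧ L.1 = Xᶜ) := by
  subst hX
  induction q using Fin.addCases with
  | left i =>
    refine Or.inl ⟨i.2, ⟨classEquiv h.1 h.2.2.2.1 i, by simp [listedEquiv], ?_⟩,
      classEquiv (A := coparallelClosures M.dual) h.1
        (by rw [coparallelClosures_dual]; exact h.2.2.2.1) i, by simp [listedDualEquiv], ?_⟩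
    all_goals
      refine (coe_classEquiv _ _ i).trans ?_
      simp [List.getElem_append_left]
  | right q =>
    right
    induction q using Fin.addCases with
    | left i =>
      refine Or.inl ⟨by simp, by simp, ⟨classEquiv h.2.1 h.2.2.2.2.1 i, by simp [listedEquiv], ?_⟩,
        classEquiv (A := parallelClosures M.dual) h.2.1 h.2.2.2.2.1 i,
        by simp [listedDualEquiv], ?_⟩
      all_goals
        refine (coe_classEquiv _ _ i).trans ?_
        simp [List.getElem_append_right]
    | right i =>
      have hget : (lP ++ lS ++ lL)[((Fin.natAdd lP.length (Fin.natAdd lS.length i) :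
          Fin (lP.length + (lS.length + lL.length))) : ℕ)]'(getElem_append_three lP lS lL _) =
          lL[i] := by
        rw [List.getElem_append_right (by simp [← add_assoc])]
        simp [← add_assoc]
      refine Or.inr ⟨by simp [← add_assoc], ⟨classEquiv h.2.2.1 h.2.2.2.2.2 i,
        by simp [listedEquiv], ?_⟩,
        complEquiv hE (classEquiv h.2.2.1 h.2.2.2.2.2 i), by simp [listedDualEquiv], ?_⟩
      · rw [coe_classEquiv, hget]
      · change (classEquiv h.2.2.1 h.2.2.2.2.2 i : Set (Fin n))ᶜ = _
        rw [coe_classEquiv, hget]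

/-- The number of listed sets. -/
def numTerm : Term := .add lenPTerm (.add lenSTerm lenLTerm)

/-- A term depending on the class of the `q`-th listed set. -/
def classTerm (a b c q : Term) : Term :=
  .cond (.le (.add lenPTerm lenSTerm) q) c (.cond (.le lenPTerm q) b a)

/-- The weight of the `q`-th listed set. -/
def weightTerm (q : Term) : Term :=
  classTerm (.add sizeTerm (.const 3)) (.add sizeTerm (.const 4))
    (.add (.add sizeTerm (.const 5)) (setRankTerm q)) q

/-- The weight of the set of the dual structure corresponding to the `q`-th listed set. -/
def dualWeightTerm (q : Term) : Term :=
  classTerm (.add sizeTerm (.const 4)) (.add sizeTerm (.const 3))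
    (.add (.add sizeTerm (.const 5)) (dualRankLTerm q)) q

/-- Membership in the set of the dual structure corresponding to the `q`-th listed set. -/
def dualBitTerm (q e : Term) : Term :=
  classTerm (bitTerm q e) (bitTerm q e) (.sub (.const 1) (bitTerm q e)) q

/-- Writes the graphs of the locked structures of the matroid and of its dual. -/
def selfDualityWriter : Writer :=
  .seq (incGraphWriter numTerm bitTerm weightTerm rankTerm)
    (incGraphWriter numTerm dualBitTerm dualWeightTerm (.sub sizeTerm rankTerm))

theorem eval_classTerm {r : ℕ} {ρ : Set (Fin n) → ℕ} (hD : Decodes ρ r lP lS lL m)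
    {env : ℕ → ℕ} {tq : Term} {q : ℕ} (hq : tq.eval m env = q) (a b c : Term) :
    (classTerm a b c tq).eval m env = if lP.length + lS.length ≤ q then c.eval m env else
      if lP.length ≤ q then b.eval m env else a.eval m env := by
  simp only [classTerm, Term.eval_cond, Term.eval_le_term, Term.eval, eval_lenPTerm hD,
    eval_lenSTerm hD, hq]
  split_ifs <;> simp_all

/-- The dual graph keeps the order of the lists of `M`. It suffices to exchange the weights of the
first two classes, complement membership in locked sets and use dual ranks; any numbering of the
vertices serves for isomorphism testing. -/
theorem word_selfDualityWriter (hE : M.E = Set.univ) (h : Lists M lP lS lL)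
    (hD : Decodes (rk M) (rk M Set.univ) lP lS lL m) (env : ℕ → ℕ) :
    selfDualityWriter.word m env =
      encodeGraph ((structureGraph M).comap (pendantEquiv (listedEquiv h))) ++
      encodeGraph ((structureGraph M.dual).comap (pendantEquiv (listedDualEquiv hE h))) := by
  classical
  have hnum : ∀ env, numTerm.eval m env = lP.length + (lS.length + lL.length) := fun env => by
    rw [numTerm, Term.eval, Term.eval, eval_lenPTerm hD, eval_lenSTerm hD, eval_lenLTerm hD]
  rw [selfDualityWriter, Writer.word]
  congr 1
  · refine word_incGraphWriter _ (eval_sizeTerm hD) hnum (eval_rankTerm hD) ?_ ?_ env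
    · intro env tq te q e hq he
      rw [eval_bitTerm hD hq he (getElem_append_three lP lS lL q)]
      rcases listed_cases h hE q _ rfl with ⟨-, ⟨P, hP, hX⟩, -⟩ | ⟨-, -, ⟨P, hP, hX⟩, -⟩ |
        ⟨-, ⟨P, hP, hX⟩, -⟩ <;> rw [hP, ← hX] <;> rfl
    · intro env tq q hq
      rw [weightTerm, eval_classTerm hD hq]
      rcases listed_cases h hE q _ rfl with ⟨h1, ⟨P, hP, hX⟩, -⟩ | ⟨h1, h2, ⟨P, hP, hX⟩, -⟩ |
        ⟨h1, ⟨P, hP, hX⟩, -⟩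
      · rw [if_neg (by omega), if_neg (by omega), hP, Term.eval, eval_sizeTerm hD]
        rfl
      · rw [if_neg (by omega), if_pos (by omega), hP, Term.eval, eval_sizeTerm hD]
        rfl
      · rw [if_pos (by omega), hP, Term.eval, Term.eval, eval_sizeTerm hD,
          eval_setRankTerm hD hq (getElem_append_three lP lS lL q), ← hX]
        rfl
  · refine word_incGraphWriter _ (eval_sizeTerm hD) hnum (fun env => ?_) ?_ ?_ env
    · rw [Term.eval, eval_sizeTerm hD, eval_rankTerm hD, rk_dual_univ hE]
    · intro env tq te q e hq he
      rw [dualBitTerm, eval_classTerm hD hq, Term.eval,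
        eval_bitTerm hD hq he (getElem_append_three lP lS lL q)]
      rcases listed_cases h hE q _ rfl with ⟨h1, -, P, hP, hX⟩ | ⟨h1, h2, -, P, hP, hX⟩ |
        ⟨h1, -, P, hP, hX⟩
      · rw [if_neg (by omega), if_neg (by omega), hP, ← hX]
        rfl
      · rw [if_neg (by omega), if_pos (by omega), hP, ← hX]
        rfl
      · rw [if_pos (by omega), hP]
        simp only [Listed.set, hX, Term.eval, Set.mem_compl_iff]
        split_ifs <;> simp_all
    · intro env tq q hq
      rw [dualWeightTerm, eval_classTerm hD hq]
      rcases listed_cases h hE q _ rfl with ⟨h1, -, P, hP, hX⟩ | ⟨h1, h2, -, P, hP, hX⟩ |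
        ⟨h1, -, P, hP, hX⟩
      · rw [if_neg (by omega), if_neg (by omega), hP, Term.eval, eval_sizeTerm hD]
        rfl
      · rw [if_neg (by omega), if_pos (by omega), hP, Term.eval, eval_sizeTerm hD]
        rfl
      · rw [if_pos (by omega), hP, Term.eval, Term.eval, eval_sizeTerm hD,
          eval_dualRankLTerm hE hD hq (getElem_append_three lP lS lL q), ← hX]
        rfl

theorem nonempty_iso_structureGraph_iff (hE : M.E = Set.univ) (hM : TwoConnected M) :
    Nonempty (structureGraph M ≃g structureGraph M.dual) ↔ SelfDual M := by
  rw [selfDual_iff_incGraph hE hM, structureGraph, structureGraph, nonempty_pendantGraph_iso_iff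
    (two_le_incWeight M) (incWeight_le M) (two_le_incWeight M.dual) (incWeight_le M.dual)]

end

/-! ### Assembly of the two algorithms. -/

theorem nonempty_iso_comap_iff {V V' U U' : Type*} (e : V ≃ U) (e' : V' ≃ U') (G : SimpleGraph U)
    (G' : SimpleGraph U') : Nonempty (G.comap e ≃g G'.comap e') ↔ Nonempty (G ≃g G') :=
  ⟨fun ⟨f⟩ => ⟨((SimpleGraph.Iso.comap e G).symm.trans f).trans (SimpleGraph.Iso.comap e' G')⟩,
    fun ⟨f⟩ => ⟨((SimpleGraph.Iso.comap e G).trans f).trans (SimpleGraph.Iso.comap e' G').symm⟩⟩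

theorem le_eval_of_mem_code {c k : ℕ} (x : KLockedMatroid c k) (w : List ℕ)
    (hw : CodesAnswer (lockedOracle c k x.M) w) (a : ℕ) (ha : a ∈ w) :
    a ≤ (Polynomial.X + 1 + Polynomial.C c * Polynomial.X ^ k : Polynomial ℕ).eval x.n := by
  obtain ⟨lP, lS, lL, hl, rfl⟩ := (codesAnswer_iff x.ground_eq x.locked_le).mp hw
  simpa using le_of_mem_codeWord x.ground_eq x.locked_le hl ha

end LockedMatroid

theorem corollary3p5 (c k : ℕ) :
    LockedMatroid.PolyTimeReducible
        (LockedMatroid.testingSelfDuality c k) LockedMatroid.graphIsomorphism ∧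
      LockedMatroid.PolyTimeComputable (LockedMatroid.kLockedMatroids c k)
        (fun x w => LockedMatroid.CodesAnswer (LockedMatroid.lockedOracle c k x.M.dual) w) := by
  open LockedMatroid in
  constructor
  · refine polyTimeComputable_of_writer selfDualityWriter
      (Polynomial.X + 1 + Polynomial.C c * Polynomial.X ^ k) le_eval_of_mem_code ?_
    intro x w hw
    obtain ⟨lP, lS, lL, hl, rfl⟩ := (codesAnswer_iff x.ground_eq x.locked_le).mp hw
    refine ⟨⟨_, _, (structureGraph x.M).comap (pendantEquiv (listedEquiv hl)),
      (structureGraph x.M.dual).comap (pendantEquiv (listedDualEquiv x.ground_eq hl))⟩,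
      word_selfDualityWriter x.ground_eq hl (decodes_codeWord _ _ lP lS lL) _, ?_⟩
    exact (nonempty_iso_structureGraph_iff x.ground_eq x.twoConnected).symm.trans
      (nonempty_iso_comap_iff _ _ _ _).symm
  · refine polyTimeComputable_of_writer dualWriter
      (Polynomial.X + 1 + Polynomial.C c * Polynomial.X ^ k) le_eval_of_mem_code ?_
    intro x w hw
    obtain ⟨lP, lS, lL, hl, rfl⟩ := (codesAnswer_iff x.ground_eq x.locked_le).mp hw
    -- The dual has the same number of locked sets, so the oracle with the same constant answers
    -- positively for it.
    rw [codesAnswer_iff (M := x.M.dual) x.ground_eq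
      (by rw [lockedNumber_dual x.ground_eq]; exact x.locked_le)]
    exact ⟨lS, lP, lL.map compl, hl.dual x.ground_eq,
      word_dualWriter x.ground_eq x.twoConnected hl (decodes_codeWord _ _ lP lS lL)⟩
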